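/- Let $\lambda_1,\lambda_2\in\mathbb{C}\setminus\{0,1\}$ and let $\mathcal{E}_n$ be the elliptic curve $y_n^2=x_n(x_n-1)(x_n-\lambda_n)$, $n=1,2$. Put $$L(v)=(\lambda_1-1)(\lambda_2-1)\,v-2(\lambda_1+1)(\lambda_2+1).$$ Let $\mathcal{S}$ and $\mathcal{Y}'$ be the Jacobian elliptic K3 surfaces over $\mathbb{P}^1$ (with affine coordinate $v$) that are the minimal resolutions of the Weierstrass models $$\mathcal{S}:\quad y^2=x^3+(v^2-4)\,L(v)\,x^2+16\lambda_1\lambda_2\,(v^2-4)^2\,x,$$ $$\mathcal{Y}':\quad Y^2=X^3-\tfrac12(v^2-4)\,L(v)\,X^2+\tfrac1{16}(v^2-4)^2\big(L(v)^2-64\lambda_1\lambda_2\big)X,$$ with the holomorphic two-forms $\omega_{\mathcal{S}}=2\,dv\wedge dx/y$ and $\omega_{\mathcal{Y}'}=dv\wedge dX/Y$. Then $\mathcal{S}$ is birational over $\mathbb{C}$ (hence, both being K3 surfaces, isomorphic) to the Kummer surface $\operatorname{Kum}(\mathcal{E}_1\times\mathcal{E}_2)$, the minimal resolution of $(\mathcal{E}_1\times\mathcal{E}_2)/\langle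 -\mathbb{I}\rangle$. The sections $T:(x,y)=(0,0)$ of $\mathcal{S}$ and $T':(X,Y)=(0,0)$ of $\mathcal{Y}'$ have order two in the Mordell–Weil groups, and the fibrewise translations by $T$ and $T'$ are Van Geemen–Sarti involutions $k$ of $\mathcal{S}$ and $k'$ of $\mathcal{Y}'$; that is, they are involutions that preserve the holomorphic two-forms. Moreover there are rational maps over $\mathbb{P}^1$ $$\chi:\mathcal{S}\dashrightarrow\mathcal{Y}',\qquad \chi':\mathcal{Y}'\dashrightarrow\mathcal{S}$$ which are fibrewise isogenies of degree two with kernels generated by $T$ and $T'$, respectively, which are dual to each other (both compositions $\chi'\circ\chi$ and $\chi\circ\chi'$ are multiplication by two in the fibres), which identify $\mathcal{Y}'$ and $\mathcal{S}$ birationally with the quotients $\mathcal{S}/\langle k\rangle$ and $\mathcal{Y}'/\langle k'\rangle$, and which satisfy $$\chi^*\omega_{\mathcal{Y}'}=\omega_{\mathcal{S}},\qquad (\chi')^*\omega_{\mathcal{S}}=2\,\omega_{\mathcal{Y}'}.$$ (Equivalently, $\chi^*(dv\wedge dX/Y)=2\,dv\wedge dx/y$ and $(\chi')^*(dv\wedge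 dx/y)=dv\wedge dX/Y$.) -/

import Mathlib

noncomputable section

namespace KummerSandwich

open Polynomial TensorProduct
open scoped Polynomial.Bivariate Classical

/-! ## Rational two-forms

A surface over `ℂ` with function field `K` has the rational two-forms `⋀[K]^2 Ω[K⁄ℂ]`.
A dominant rational map `X ⇢ X'` of complex surfaces is an embedding `K(X') →ₐ[ℂ] K(X)` of function
fields (its comorphism), and it pulls rational two-forms back. -/

/-- The pull-back `f d g₁ ∧ d g₂ ↦ φ f d (φ g₁) ∧ d (φ g₂)` of rational two-forms along the dominant
rational map with comorphism `φ`. -/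
def pullback {K' K : Type} [Field K'] [Field K] [Algebra ℂ K'] [Algebra ℂ K] (φ : K' →ₐ[ℂ] K) :
    ⋀[K']^2 Ω[K'⁄ℂ] → ⋀[K]^2 Ω[K⁄ℂ] :=
  letI : Algebra K' K := φ.toRingHom.toAlgebra
  haveI : IsScalarTower ℂ K' K := IsScalarTower.of_algebraMap_eq' φ.comp_algebraMap.symm
  exteriorPower.alternatingMapLinearEquiv
    ({ (((exteriorPower.ιMulti K 2 (M := Ω[K⁄ℂ])).toMultilinearMap.restrictScalars
          K').compLinearMap fun _ => KaehlerDifferential.map ℂ ℂ K' K) with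
      map_eq_zero_of_eq' := fun _ _ _ h hij =>
        (exteriorPower.ιMulti K 2 (M := Ω[K⁄ℂ])).map_eq_zero_of_eq _
          (congrArg (KaehlerDifferential.map ℂ ℂ K' K) h) hij } :
      Ω[K'⁄ℂ] [⋀^Fin 2]→ₗ[K'] ⋀[K]^2 Ω[K⁄ℂ])

/-- The rational two-form `d f ∧ d g`. -/
def dWedge {K : Type} [Field K] [Algebra ℂ K] (f g : K) : ⋀[K]^2 Ω[K⁄ℂ] :=
  exteriorPower.ιMulti K 2 ![KaehlerDifferential.D ℂ K f, KaehlerDifferential.D ℂ K g]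

theorem pullback_smul_dWedge {K' K : Type} [Field K'] [Field K] [Algebra ℂ K'] [Algebra ℂ K]
    (φ : K' →ₐ[ℂ] K) (h f g : K') :
    pullback φ (h • dWedge f g) = φ h • dWedge (φ f) (φ g) := by
  let : Algebra K' K := φ.toRingHom.toAlgebra
  have : IsScalarTower ℂ K' K := IsScalarTower.of_algebraMap_eq' φ.comp_algebraMap.symm
  unfold pullback dWedge
  rw [map_smul, exteriorPower.alternatingMapLinearEquiv_apply_ιMulti]
  have key : (fun i => KaehlerDifferential.map ℂ ℂ K' K
      (![KaehlerDifferential.D ℂ K' f, KaehlerDifferential.D ℂ K' g] i)) =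
      ![KaehlerDifferential.D ℂ K (φ f), KaehlerDifferential.D ℂ K (φ g)] := by
    funext i
    fin_cases i <;> exact KaehlerDifferential.map_D ℂ ℂ K' K _
  have h2 := congrArg (fun m => φ h • exteriorPower.ιMulti K 2 (M := Ω[K⁄ℂ]) m) key
  refine Eq.trans ?_ h2
  apply Subtype.ext
  exact algebraMap_smul K h _ |>.symm

/-! ## Jacobian elliptic K3 surfaces with a marked two-torsion section -/

/-- The function field `ℂ(v)` of the base curve `ℙ¹` of the elliptic fibrations. -/
abbrev BaseField : Type := RatFunc ℂ

/-- A Jacobian elliptic K3 surface `π : 𝒳 → ℙ¹` over `ℂ` with a section of order two, given by the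
minimal Weierstrass equation `y² = x³ + A(v) x² + B(v) x`, where the two-torsion section has been
moved to `(x, y) = (0, 0)`.

The surface is the minimal resolution of the Weierstrass model over `ℙ¹`. The degree bounds say that
`A` and `B` are sections of `𝒪(4)` and `𝒪(8)`; the equation has to be minimal at every finite place
`v = c` and at `v = ∞`. This is precisely the condition that the Weierstrass model has at worst
rational double points and that its minimal resolution is a K3 surface. -/
structure TwoTorsionK3 where
  A : ℂ[X]
  B : ℂ[X]
  natDegree_A_le : A.natDegree ≤ 4
  natDegree_B_le : B.natDegree ≤ 8
  B_ne_zero : B ≠ 0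
  disc_ne_zero : A ^ 2 - 4 * B ≠ 0
  minimal : ∀ c : ℂ, ¬ ((X - C c) ^ 2 ∣ A ∧ (X - C c) ^ 4 ∣ B)
  minimal_infty : ¬ (A.natDegree ≤ 2 ∧ B.natDegree ≤ 4)

namespace TwoTorsionK3

variable (S : TwoTorsionK3)

/-- The generic fibre of the fibration, an elliptic curve over `ℂ(v)`. -/
def genericFibre : WeierstrassCurve.Affine BaseField :=
  ⟨0, algebraMap ℂ[X] BaseField S.A, 0, algebraMap ℂ[X] BaseField S.B, 0⟩

instance : S.genericFibre.IsElliptic := by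
  rw [WeierstrassCurve.isElliptic_iff, isUnit_iff_ne_zero]
  have h : S.genericFibre.Δ = algebraMap ℂ[X] BaseField (16 * S.B ^ 2 * (S.A ^ 2 - 4 * S.B)) := by
    simp only [WeierstrassCurve.Δ, WeierstrassCurve.b₂, WeierstrassCurve.b₄, WeierstrassCurve.b₆,
      WeierstrassCurve.b₈, genericFibre, map_mul, map_sub, map_pow, map_ofNat]
    ring
  rw [h, Ne, FaithfulSMul.algebraMap_eq_zero_iff]
  exact mul_ne_zero (mul_ne_zero (by norm_num) (pow_ne_zero _ S.B_ne_zero)) S.disc_ne_zero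

instance (L : Type) [Field L] [Algebra BaseField L] :
    (S.genericFibre.baseChange L).IsElliptic :=
  inferInstanceAs ((WeierstrassCurve.map S.genericFibre (algebraMap BaseField L)).IsElliptic)

/-- The function field of the surface, that is, of its generic fibre over `ℂ(v)`. -/
def FunctionField : Type := WeierstrassCurve.Affine.FunctionField S.genericFibre

instance : Field S.FunctionField :=
  inferInstanceAs (Field (WeierstrassCurve.Affine.FunctionField S.genericFibre))

instance : Algebra S.genericFibre.CoordinateRing S.FunctionField :=
  inferInstanceAs (Algebra S.genericFibre.CoordinateRing
    (WeierstrassCurve.Affine.FunctionField S.genericFibre))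

instance : IsFractionRing S.genericFibre.CoordinateRing S.FunctionField :=
  inferInstanceAs (IsFractionRing S.genericFibre.CoordinateRing
    (WeierstrassCurve.Affine.FunctionField S.genericFibre))

instance : Algebra BaseField S.FunctionField :=
  inferInstanceAs (Algebra BaseField (WeierstrassCurve.Affine.FunctionField S.genericFibre))

instance : Algebra ℂ S.FunctionField :=
  inferInstanceAs (Algebra ℂ (WeierstrassCurve.Affine.FunctionField S.genericFibre))

instance : IsScalarTower BaseField S.genericFibre.CoordinateRing S.FunctionField :=
  inferInstanceAs (IsScalarTower BaseField S.genericFibre.CoordinateRing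
    (WeierstrassCurve.Affine.FunctionField S.genericFibre))

instance : IsScalarTower ℂ BaseField S.FunctionField :=
  inferInstanceAs (IsScalarTower ℂ BaseField
    (WeierstrassCurve.Affine.FunctionField S.genericFibre))

/-- The rational function `r / d` on the surface, for polynomials `r, d` in the fibre coordinates
`x, y` with coefficients in `ℂ(v)`. -/
def ratio (r d : BaseField[X][Y]) : S.FunctionField :=
  algebraMap S.genericFibre.CoordinateRing S.FunctionField
      (WeierstrassCurve.Affine.CoordinateRing.mk S.genericFibre r) /
    algebraMap S.genericFibre.CoordinateRing S.FunctionField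
      (WeierstrassCurve.Affine.CoordinateRing.mk S.genericFibre d)

/-- The affine coordinate `v` of the base, as a rational function on the surface. -/
def v : S.FunctionField := algebraMap BaseField S.FunctionField RatFunc.X

/-- The fibre coordinate `x`. -/
def x : S.FunctionField := S.ratio (C X) 1

/-- The fibre coordinate `y`. -/
def y : S.FunctionField := S.ratio Y 1

/-- The group of points of the generic fibre over an extension field `L` of `ℂ(v)`. For `L = ℂ(v)`
it is the Mordell-Weil group of sections of the fibration. -/
abbrev Points (L : Type) [Field L] [Algebra BaseField L] : Type := (S.genericFibre.baseChange L).Point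

/-- The Mordell-Weil group of sections of the fibration. -/
abbrev MordellWeil : Type := S.Points BaseField

/-- The two-torsion section `(x, y) = (0, 0)`, as a point over an extension field `L` of `ℂ(v)`. -/
def T (L : Type) [Field L] [Algebra BaseField L] : S.Points L :=
  WeierstrassCurve.Affine.Point.mk (x := 0) (y := 0) <| by
    rw [WeierstrassCurve.Affine.equation_zero]
    simp [genericFibre]

theorem equation_genericPoint :
    (S.genericFibre.baseChange S.FunctionField).Equation S.x S.y := by
  have h : algebraMap S.genericFibre.CoordinateRing S.FunctionField
      (WeierstrassCurve.Affine.CoordinateRing.mk S.genericFibre S.genericFibre.polynomial) = 0 := by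
    rw [AdjoinRoot.mk_self, map_zero]
  have hc : ∀ a : BaseField, algebraMap S.genericFibre.CoordinateRing S.FunctionField
      (WeierstrassCurve.Affine.CoordinateRing.mk S.genericFibre (C (C a))) =
      algebraMap BaseField S.FunctionField a := fun a =>
    (IsScalarTower.algebraMap_apply BaseField S.genericFibre.CoordinateRing S.FunctionField a).symm
  rw [WeierstrassCurve.Affine.equation_iff]
  simp only [WeierstrassCurve.Affine.polynomial, map_add, map_sub, map_mul, map_pow, hc] at h
  simp only [x, y, ratio, map_one, div_one]
  simp only [genericFibre, map_zero, WeierstrassCurve.baseChange, WeierstrassCurve.map_a₁,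
    WeierstrassCurve.map_a₂, WeierstrassCurve.map_a₃, WeierstrassCurve.map_a₄,
    WeierstrassCurve.map_a₆] at h ⊢
  linear_combination h

/-- The generic point `(x, y)` of the generic fibre. -/
def genericPoint : S.Points S.FunctionField :=
  WeierstrassCurve.Affine.Point.mk S.equation_genericPoint

/-- The holomorphic two-form `dv ∧ dx / y`. -/
def twoForm : ⋀[S.FunctionField]^2 Ω[S.FunctionField⁄ℂ] := S.y⁻¹ • dWedge S.v S.x

/-- `k` is (the comorphism of) fibrewise translation by the section `T : (x, y) = (0, 0)`: it covers
the identity of the base, and it sends the generic point `P` of the fibre to `P + T`. -/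
def IsTranslation (k : S.FunctionField ≃ₐ[BaseField] S.FunctionField) : Prop :=
  WeierstrassCurve.Affine.Point.map (W' := S.genericFibre) (k : S.FunctionField →ₐ[BaseField] S.FunctionField)
      S.genericPoint = S.genericPoint + S.T S.FunctionField

/-- `k` is a Nikulin involution: an automorphism of order two that preserves the holomorphic
two-form. Since a birational self-map of a K3 surface is an automorphism, `Aut` of the surface is the
group of `ℂ`-automorphisms of its function field. -/
def IsNikulinInvolution (k : S.FunctionField ≃ₐ[ℂ] S.FunctionField) : Prop :=
  orderOf k = 2 ∧ pullback (k : S.FunctionField →ₐ[ℂ] S.FunctionField) S.twoForm = S.twoForm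

/-- `k` is the Van Geemen-Sarti involution of the two-torsion section `T : (x, y) = (0, 0)`: the
section has order two in the Mordell-Weil group, `k` is the fibrewise translation by it, and it is a
Nikulin involution. -/
structure IsVanGeemenSartiInvolution (k : S.FunctionField ≃ₐ[BaseField] S.FunctionField) :
    Prop where
  orderTwo : addOrderOf (S.T BaseField : S.MordellWeil) = 2
  translation : S.IsTranslation k
  nikulin : S.IsNikulinInvolution (k.restrictScalars ℂ)

/-- The algebraic closure of `ℂ(v)`. -/
def GeomField : Type := AlgebraicClosure BaseField

instance : Field GeomField := inferInstanceAs (Field (AlgebraicClosure BaseField))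

instance : Algebra BaseField GeomField :=
  inferInstanceAs (Algebra BaseField (AlgebraicClosure BaseField))

instance : IsAlgClosure BaseField GeomField :=
  inferInstanceAs (IsAlgClosure BaseField (AlgebraicClosure BaseField))

/-- The value at a point `(a, b)` over `L` of a polynomial in the fibre coordinates `x, y` with
coefficients in `ℂ(v)`. -/
def value {L : Type} [Field L] [Algebra BaseField L] (r : BaseField[X][Y]) (a b : L) : L :=
  (r.map (mapRingHom (algebraMap BaseField L))).evalEval a b

/-- The group homomorphism `f` on points over `L` agrees with the rational map with comorphism `φ`:
wherever the coordinates of the image are `r / d` and `s / d` with `d ≠ 0`, the image is the point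
with these coordinates. -/
def AgreesOnPoints (S S' : TwoTorsionK3) (L : Type) [Field L] [Algebra BaseField L]
    (φ : S'.FunctionField →ₐ[BaseField] S.FunctionField) (f : S.Points L →+ S'.Points L) : Prop :=
  ∀ (a b : L) (h : (S.genericFibre.baseChange L).Nonsingular a b) (r s d : BaseField[X][Y]),
    value d a b ≠ 0 → φ S'.x = S.ratio r d → φ S'.y = S.ratio s d →
    ∃ h' : (S'.genericFibre.baseChange L).Nonsingular (value r a b / value d a b)
        (value s a b / value d a b),
      f (WeierstrassCurve.Affine.Point.some a b h) = WeierstrassCurve.Affine.Point.some _ _ h'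

/-- A fibrewise isogeny `𝒳 ⇢ 𝒳'` over the identity of the base: a dominant rational map over `ℙ¹`
that is a group homomorphism on the geometric generic fibre. -/
def Isogeny (S S' : TwoTorsionK3) : Type :=
  { p : (S'.FunctionField →ₐ[BaseField] S.FunctionField) × (S.Points GeomField →+ S'.Points GeomField)
    // AgreesOnPoints S S' GeomField p.1 p.2 }

namespace Isogeny

variable {S S' : TwoTorsionK3}

/-- The comorphism of an isogeny, over the function field `ℂ(v)` of the base. -/
def comorphism (χ : Isogeny S S') : S'.FunctionField →ₐ[BaseField] S.FunctionField := χ.1.1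

/-- The isogeny as a homomorphism on geometric points of the generic fibre. -/
def onPoints (χ : Isogeny S S') : S.Points GeomField →+ S'.Points GeomField := χ.1.2

/-- The underlying rational map of complex surfaces, through its comorphism. -/
def rationalMap (χ : Isogeny S S') : S'.FunctionField →ₐ[ℂ] S.FunctionField :=
  χ.comorphism.restrictScalars ℂ

/-- The isogeny is a two-isogeny with kernel generated by the two-torsion section. -/
def IsTwoIsogeny (χ : Isogeny S S') : Prop :=
  Nat.card χ.onPoints.ker = 2 ∧ χ.onPoints.ker = AddSubgroup.zmultiples (S.T GeomField)

/-- The rational map identifies the target, birationally, with the quotient by the involution `k`: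
the functions on the target are the `k`-invariant functions. -/
def IsQuotientBy (χ : Isogeny S S') (k : S.FunctionField ≃ₐ[BaseField] S.FunctionField) : Prop :=
  ∀ f : S.FunctionField, f ∈ χ.comorphism.range ↔ k f = f

/-- Two two-isogenies are dual: both compositions are multiplication by two in the fibres. -/
def AreDual (χ : Isogeny S S') (χ' : Isogeny S' S) : Prop :=
  (∀ P, χ'.onPoints (χ.onPoints P) = 2 • P) ∧ ∀ P, χ.onPoints (χ'.onPoints P) = 2 • P

end Isogeny

end TwoTorsionK3

/-! ## The Kummer surface of a product of two elliptic curves -/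

/-- The Legendre curve `y² = x (x - 1) (x - l)`. -/
def legendre (l : ℂ) : WeierstrassCurve.Affine ℂ := ⟨0, -(1 + l), 0, l, 0⟩

/-- Inversion `(x, y) ↦ (x, -y - a₁ x - a₃)` on the coordinate ring of an affine Weierstrass curve. -/
def inversionHom (W : WeierstrassCurve.Affine ℂ) : W.CoordinateRing →ₐ[ℂ] W.CoordinateRing :=
  AdjoinRoot.liftAlgHom W.polynomial (IsScalarTower.toAlgHom ℂ ℂ[X] W.CoordinateRing)
    (WeierstrassCurve.Affine.CoordinateRing.mk W W.negPolynomial) <| by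
      have h : WeierstrassCurve.Affine.CoordinateRing.mk W W.polynomial = 0 := AdjoinRoot.mk_self
      have hc : ∀ p : ℂ[X], algebraMap ℂ[X] W.CoordinateRing p =
        WeierstrassCurve.Affine.CoordinateRing.mk W (C p) := fun _ => rfl
      simp only [WeierstrassCurve.Affine.polynomial, WeierstrassCurve.Affine.negPolynomial,
        map_add, map_sub, map_mul, map_pow, map_neg] at h ⊢
      simp only [eval₂_add, eval₂_sub, eval₂_mul, eval₂_pow, eval₂_C, eval₂_X, RingHom.coe_coe,
        IsScalarTower.coe_toAlgHom', hc]
      linear_combination h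

theorem inversionHom_comp (W : WeierstrassCurve.Affine ℂ) :
    (inversionHom W).comp (inversionHom W) = AlgHom.id ℂ _ := by
  have hc : ∀ p : ℂ[X], inversionHom W (WeierstrassCurve.Affine.CoordinateRing.mk W (C p)) =
      WeierstrassCurve.Affine.CoordinateRing.mk W (C p) := fun p =>
    AdjoinRoot.liftAlgHom_of _ _ _ _ p
  have hy : inversionHom W (WeierstrassCurve.Affine.CoordinateRing.mk W Y) =
      WeierstrassCurve.Affine.CoordinateRing.mk W W.negPolynomial :=
    AdjoinRoot.liftAlgHom_root _ _ _ _
  apply AlgHom.ext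
  intro f
  obtain ⟨p, q, rfl⟩ := WeierstrassCurve.Affine.CoordinateRing.exists_smul_basis_eq f
  simp only [AlgHom.comp_apply, AlgHom.id_apply, WeierstrassCurve.Affine.CoordinateRing.smul,
    map_add, map_mul, map_one, hc, hy, WeierstrassCurve.Affine.negPolynomial, map_sub, map_neg]
  ring

/-- Inversion as an automorphism of the coordinate ring. -/
def inversion (W : WeierstrassCurve.Affine ℂ) : W.CoordinateRing ≃ₐ[ℂ] W.CoordinateRing :=
  AlgEquiv.ofAlgHom (inversionHom W) (inversionHom W) (inversionHom_comp W) (inversionHom_comp W)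

/-- The function field of `E₁ × E₂`: the fractions of the coordinate ring `ℂ[E₁] ⊗ ℂ[E₂]` of the
product of the affine curves. -/
abbrev ProductField (E₁ E₂ : WeierstrassCurve.Affine ℂ) : Type :=
  FractionRing (E₁.CoordinateRing ⊗[ℂ] E₂.CoordinateRing)

/-- The inversion automorphism `-𝕀 = ι₁ × ι₂` of the abelian surface `E₁ × E₂`. -/
def productInversion (E₁ E₂ : WeierstrassCurve.Affine ℂ) :
    ProductField E₁ E₂ ≃ₐ[ℂ] ProductField E₁ E₂ :=
  IsFractionRing.algEquivOfAlgEquiv (A := E₁.CoordinateRing ⊗[ℂ] E₂.CoordinateRing)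
    (B := E₁.CoordinateRing ⊗[ℂ] E₂.CoordinateRing)
    (Algebra.TensorProduct.congr (inversion E₁) (inversion E₂))

/-- The function field of the Kummer surface `Kum(E₁ × E₂)`, the minimal resolution of
`(E₁ × E₂) / ⟨-𝕀⟩`: the functions on `E₁ × E₂` invariant under inversion. -/
def kummerField (E₁ E₂ : WeierstrassCurve.Affine ℂ) : Subalgebra ℂ (ProductField E₁ E₂) :=
  AlgHom.equalizer (productInversion E₁ E₂ : ProductField E₁ E₂ →ₐ[ℂ] ProductField E₁ E₂)
    (AlgHom.id ℂ _)

/-! ## The two K3 surfaces -/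

/-- The modular parameters of Legendre curves, `λ ∈ ℙ¹ \ {0, 1, ∞}`. -/
abbrev ModularParameter : Type := { l : ℂ // l ≠ 0 ∧ l ≠ 1 }

/-- The linear polynomial `(λ₁ - 1) (λ₂ - 1) v - 2 (λ₁ + 1) (λ₂ + 1)`. -/
def linearFactor (l₁ l₂ : ℂ) : ℂ[X] :=
  C ((l₁ - 1) * (l₂ - 1)) * X - C (2 * (l₁ + 1) * (l₂ + 1))

theorem base_ne_zero : (X ^ 2 - 4 : ℂ[X]) ≠ 0 := by
  intro h
  have := congrArg (eval 0) h
  norm_num at this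

theorem leading_ne_zero (l₁ l₂ : ModularParameter) : ((l₁ : ℂ) - 1) * (l₂ - 1) ≠ 0 :=
  mul_ne_zero (sub_ne_zero.2 l₁.2.2) (sub_ne_zero.2 l₂.2.2)

theorem constant_ne_zero (l₁ l₂ : ModularParameter) : (16 * (l₁ : ℂ) * l₂) ≠ 0 :=
  mul_ne_zero (mul_ne_zero (by norm_num) l₁.2.1) l₂.2.1

theorem quadratic_ne_zero (l₁ l₂ : ModularParameter) :
    linearFactor l₁ l₂ ^ 2 - C (64 * (l₁ : ℂ) * l₂) ≠ 0 := by
  intro h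
  have h2 := congrArg (fun p => eval 0 (derivative (derivative p))) h
  simp [linearFactor, pow_two] at h2
  have := leading_ne_zero l₁ l₂
  have h1 := sub_ne_zero.2 l₁.2.2
  have h3 := sub_ne_zero.2 l₂.2.2
  simp_all

/-- A polynomial divisible by `(X - c)³` vanishes at `c` with its first two derivatives. -/
theorem eval_of_pow_three_dvd {p : ℂ[X]} {c : ℂ} (h : (X - C c) ^ 3 ∣ p) :
    p.eval c = 0 ∧ (derivative p).eval c = 0 ∧ (derivative (derivative p)).eval c = 0 := by
  obtain ⟨q, rfl⟩ := h
  simp [derivative_pow]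

/-- A polynomial divisible by `(X - c)²` vanishes at `c` with its derivative. -/
theorem eval_of_pow_two_dvd {p : ℂ[X]} {c : ℂ} (h : (X - C c) ^ 2 ∣ p) :
    p.eval c = 0 ∧ (derivative p).eval c = 0 := by
  obtain ⟨q, rfl⟩ := h
  simp [derivative_pow]

theorem coeff_three (l₁ l₂ : ℂ) :
    ((X ^ 2 - 4) * linearFactor l₁ l₂).coeff 3 = (l₁ - 1) * (l₂ - 1) := by
  have h4 : (X ^ 2 - 4) * linearFactor l₁ l₂ = C ((l₁ - 1) * (l₂ - 1)) * X ^ 3 -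
      C (2 * (l₁ + 1) * (l₂ + 1)) * X ^ 2 - C (4 * ((l₁ - 1) * (l₂ - 1))) * X +
      C (4 * (2 * (l₁ + 1) * (l₂ + 1))) := by
    rw [linearFactor, map_mul C 4, map_mul C 4, map_ofNat]
    ring
  rw [h4]
  simp [-map_mul, -map_add, -map_sub]

/-- The fibration
`y² = x³ + (v² - 4) ((λ₁ - 1)(λ₂ - 1) v - 2 (λ₁ + 1)(λ₂ + 1)) x² + 16 λ₁ λ₂ (v² - 4)² x`
on the Kummer surface of `E₁ × E₂`. -/
def kummerSurface (l₁ l₂ : ModularParameter) : TwoTorsionK3 where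
  A := (X ^ 2 - 4) * linearFactor l₁ l₂
  B := C (16 * (l₁ : ℂ) * l₂) * (X ^ 2 - 4) ^ 2
  natDegree_A_le := by unfold linearFactor; compute_degree; norm_num
  natDegree_B_le := by compute_degree; norm_num
  B_ne_zero := mul_ne_zero (C_ne_zero.2 (mul_ne_zero (mul_ne_zero (by norm_num) l₁.2.1) l₂.2.1))
    (pow_ne_zero 2 base_ne_zero)
  disc_ne_zero := by
    have h : ((X ^ 2 - 4) * linearFactor l₁ l₂) ^ 2 -
        4 * (C (16 * (l₁ : ℂ) * l₂) * (X ^ 2 - 4) ^ 2) =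
        (X ^ 2 - 4) ^ 2 * (linearFactor l₁ l₂ ^ 2 - C (64 * (l₁ : ℂ) * l₂)) := by
      simp only [map_mul, map_ofNat]
      ring
    rw [h]
    exact mul_ne_zero (pow_ne_zero 2 base_ne_zero) (quadratic_ne_zero l₁ l₂)
  minimal := fun c hc => by
    obtain ⟨h0, -, h2⟩ := eval_of_pow_three_dvd ((pow_dvd_pow _ (by norm_num)).trans hc.2)
    have hk := constant_ne_zero l₁ l₂
    generalize (16 * (l₁ : ℂ) * l₂) = k at h0 h2 hk
    simp only [eval_mul, eval_C, eval_pow, eval_sub, eval_X, eval_ofNat, derivative_mul,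
      derivative_C, derivative_pow, derivative_sub, derivative_X, derivative_ofNat, derivative_add,
      eval_add, eval_zero, eval_one, derivative_zero, derivative_one] at h0 h2
    have h4 : c ^ 2 - 4 = 0 := by simpa [hk] using h0
    norm_num [hk] at h2
    have h5 : (32 : ℂ) = 0 := by linear_combination h2 - 12 * h4
    norm_num at h5
  minimal_infty := fun h => by
    have h3 : ((X ^ 2 - 4) * linearFactor l₁ l₂).coeff 3 = 0 :=
      coeff_eq_zero_of_natDegree_lt (by omega)
    rw [coeff_three] at h3
    exact leading_ne_zero l₁ l₂ h3

/-- The K3 surface `𝒴'` with the fibration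
`Y² = X³ - ½ (v² - 4) ((λ₁ - 1)(λ₂ - 1) v - 2 (λ₁ + 1)(λ₂ + 1)) X²
  + (1/16) (v² - 4)² (((λ₁ - 1)(λ₂ - 1) v - 2 (λ₁ + 1)(λ₂ + 1))² - 64 λ₁ λ₂) X`. -/
def isogenousSurface (l₁ l₂ : ModularParameter) : TwoTorsionK3 where
  A := C (-1 / 2) * (X ^ 2 - 4) * linearFactor l₁ l₂
  B := C (1 / 16) * (X ^ 2 - 4) ^ 2 * (linearFactor l₁ l₂ ^ 2 - C (64 * (l₁ : ℂ) * l₂))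
  natDegree_A_le := by unfold linearFactor; compute_degree; norm_num
  natDegree_B_le := by unfold linearFactor; compute_degree; norm_num
  B_ne_zero := mul_ne_zero (mul_ne_zero (C_ne_zero.2 (by norm_num)) (pow_ne_zero 2 base_ne_zero))
    (quadratic_ne_zero l₁ l₂)
  disc_ne_zero := by
    have h : (C (-1 / 2) * (X ^ 2 - 4) * linearFactor l₁ l₂) ^ 2 -
        4 * (C (1 / 16) * (X ^ 2 - 4) ^ 2 * (linearFactor l₁ l₂ ^ 2 - C (64 * (l₁ : ℂ) * l₂))) =
        C (16 * (l₁ : ℂ) * l₂) * (X ^ 2 - 4) ^ 2 := by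
      have h4 : (4 : ℂ[X]) = C 4 := rfl
      have e1 : C (-1 / 2 : ℂ) ^ 2 = 4 * C (1 / 16) := by
        rw [h4, ← C_pow, ← C_mul]
        norm_num
      have e2 : 4 * C (1 / 16) * C (64 * (l₁ : ℂ) * l₂) = C (16 * (l₁ : ℂ) * l₂) := by
        rw [h4, ← C_mul, ← C_mul]
        congr 1
        ring
      linear_combination (X ^ 2 - 4) ^ 2 * linearFactor l₁ l₂ ^ 2 * e1 + (X ^ 2 - 4) ^ 2 * e2
    rw [h]
    exact mul_ne_zero (C_ne_zero.2 (mul_ne_zero (mul_ne_zero (by norm_num) l₁.2.1) l₂.2.1))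
      (pow_ne_zero 2 base_ne_zero)
  minimal := fun c hc => by
    obtain ⟨a0, a1⟩ := eval_of_pow_two_dvd hc.1
    obtain ⟨b0, -, b2⟩ := eval_of_pow_three_dvd ((pow_dvd_pow _ (by norm_num)).trans hc.2)
    have hm : (64 * (l₁ : ℂ) * l₂) ≠ 0 := fun h =>
      constant_ne_zero l₁ l₂ (by linear_combination h / 4)
    generalize (64 * (l₁ : ℂ) * l₂) = m at b0 b2 hm
    generalize linearFactor l₁ l₂ = p at a0 a1 b0 b2
    simp only [eval_mul, eval_C, eval_pow, eval_sub, eval_X, eval_ofNat, derivative_mul,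
      derivative_C, derivative_pow, derivative_sub, derivative_X, derivative_ofNat, derivative_add,
      eval_add, eval_zero, eval_one, derivative_zero, derivative_one] at a0 a1 b0 b2
    norm_num at a0 a1 b0 b2
    by_cases h4 : c ^ 2 - 4 = 0
    · have hc0 : c ≠ 0 := by
        rintro rfl
        norm_num at h4
      rw [h4] at a1 b2
      have hp : eval c p = 0 := by simpa [hc0] using a1
      rw [hp] at b2
      norm_num at b2
      simp_all
    · have hp : eval c p = 0 := by simpa [h4] using a0
      rw [hp] at b0
      simp_all
  minimal_infty := fun h => by
    have h3 : (C (-1 / 2) * (X ^ 2 - 4) * linearFactor l₁ l₂).coeff 3 = 0 :=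
      coeff_eq_zero_of_natDegree_lt (by omega)
    rw [mul_assoc, coeff_C_mul, coeff_three] at h3
    exact leading_ne_zero l₁ l₂ (by linear_combination -2 * h3)

/-- The holomorphic two-form `ω_𝒮 = 2 dv ∧ dx / y` on the Kummer surface. -/
def kummerTwoForm (l₁ l₂ : ModularParameter) :
    ⋀[(kummerSurface l₁ l₂).FunctionField]^2 Ω[(kummerSurface l₁ l₂).FunctionField⁄ℂ] :=
  (2 : (kummerSurface l₁ l₂).FunctionField) • (kummerSurface l₁ l₂).twoForm

/-- The holomorphic two-form `ω_𝒴' = dv ∧ dX / Y` on `𝒴'`. -/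
def isogenousTwoForm (l₁ l₂ : ModularParameter) :
    ⋀[(isogenousSurface l₁ l₂).FunctionField]^2 Ω[(isogenousSurface l₁ l₂).FunctionField⁄ℂ] :=
  (isogenousSurface l₁ l₂).twoForm

end KummerSandwich

end

/-! All statements are reduced to computations in function fields and in groups of points of the
generic fibre over ℂ(v).

Dividing y² = x³ + A x² + B x by T = (0, 0) gives a curve of the same form. With a scaling factor m
the quotient map is X = y² / (m² x²), Y = y (x² - B) / (m³ x²), and the new coefficients are -2A /
m² and (A² - 4B) / m⁴. The surface 𝒴' is the quotient of 𝒮 with m = 2, and 𝒮 is the quotient of 𝒴'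
with m' = 1. The compositions are multiplication by two exactly because m m' = 2
(`TwoIsogenyData.toFun_toFun`), and dv ∧ dX / Y pulls back to m dv ∧ dx / y
(`TwoIsogenous.pullback_twoForm`); this explains all constants. The map on points is additive
because it carries collinear triples to collinear triples (`TwoIsogenyData.toFun_add_of_collinear`).
It is the quotient by translation because w = y / x changes sign under translation by T, has its
square in the image field, and generates the function field over it (`mem_of_fixed`,
`TwoIsogenous.isQuotientBy`).

For the Kummer surface, the invariants of -𝕀 on E₁ × E₂ form ℂ(x₁, x₂, y₁y₂). The function
`LegendrePair.u` is chosen so that x₂ is rational in u and x₁, and so that t = (x₂ - λ₂) / (x₁ (x₂ -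
1)) is a Möbius function of x₁ over ℂ(u). Up to normalization u is the base coordinate v, and t is x
up to a factor depending only on v. Hence ℂ(v, x) = ℂ(x₁, x₂), and adjoining y amounts to adjoining
y₁y₂ (`LegendrePair.nonempty_algEquiv`). -/

noncomputable section

namespace KummerSandwich

open WeierstrassCurve

/-! ## The two-isogeny on points -/

/-- A Weierstrass equation of the form `y² = x³ + a₂ x² + a₄ x`. -/
structure IsTwoTorsionModel {F : Type} [Field F] (W : Affine F) : Prop where
  a₁ : W.a₁ = 0
  a₃ : W.a₃ = 0
  a₆ : W.a₆ = 0

namespace IsTwoTorsionModel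

variable {F : Type} [Field F] {W : Affine F}

theorem equation_iff (hW : IsTwoTorsionModel W) {x y : F} :
    W.Equation x y ↔ y ^ 2 = x ^ 3 + W.a₂ * x ^ 2 + W.a₄ * x := by
  rw [Affine.equation_iff, hW.a₁, hW.a₃, hW.a₆]
  simp

theorem negY_eq (hW : IsTwoTorsionModel W) (x y : F) : W.negY x y = -y := by
  simp [Affine.negY, hW.a₁, hW.a₃]

theorem deriv_ne_zero (hW : IsTwoTorsionModel W) {x : F} (h : W.Nonsingular x 0) :
    3 * x ^ 2 + 2 * W.a₂ * x + W.a₄ ≠ 0 := by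
  have h2 := ((Affine.nonsingular_iff ..).1 h).2
  rw [hW.a₁, hW.a₃] at h2
  simpa [eq_comm] using h2

variable [DecidableEq F]

/-- Three points cut out by a line, with multiplicity, add up to zero. -/
theorem add_eq_neg_of_collinear (hW : IsTwoTorsionModel W) (h2 : (2 : F) ≠ 0)
    {x₁ y₁ x₂ y₂ x₃ y₃ l n : F} (h₁ : W.Nonsingular x₁ y₁) (h₂ : W.Nonsingular x₂ y₂)
    (h₃ : W.Nonsingular x₃ y₃) (hy₁ : y₁ = l * x₁ + n) (hy₂ : y₂ = l * x₂ + n)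
    (hy₃ : y₃ = l * x₃ + n) (e₁ : x₁ + x₂ + x₃ = l ^ 2 - W.a₂)
    (e₂ : x₁ * x₂ + x₁ * x₃ + x₂ * x₃ = W.a₄ - 2 * l * n) (e₃ : x₁ * x₂ * x₃ = n ^ 2) :
    Affine.Point.some x₁ y₁ h₁ + Affine.Point.some x₂ y₂ h₂ = -Affine.Point.some x₃ y₃ h₃ := by
  -- Opposite points on a non-vertical line coincide and have y = 0. Then x₁ is a double root of the
  -- cubic cut out by the line, and the vanishing derivative contradicts nonsingularity.
  have hxy : ¬ (x₁ = x₂ ∧ y₁ = W.negY x₂ y₂) := by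
    rintro ⟨hx, hy⟩
    rw [hW.negY_eq] at hy
    subst hx
    have h0 : y₁ = 0 := by
      have : 2 * y₁ = 0 := by linear_combination hy + hy₁ - hy₂
      simpa [h2] using this
    subst h0
    refine hW.deriv_ne_zero h₁ ?_
    linear_combination (2 * x₁) * e₁ - e₂ - 2 * l * hy₁
  have hl : W.slope x₁ x₂ y₁ y₂ = l := by
    by_cases hx : x₁ = x₂
    · have hy : y₁ ≠ W.negY x₂ y₂ := fun h => hxy ⟨hx, h⟩
      rw [Affine.slope_of_Y_ne hx hy, hW.negY_eq, hW.a₁]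
      rw [hW.negY_eq] at hy
      subst hx
      have hy' : y₁ - -y₁ ≠ 0 := by
        intro h
        exact hy (by linear_combination h - hy₁ + hy₂)
      rw [div_eq_iff hy']
      linear_combination (2 * x₁) * e₁ - e₂ - 2 * l * hy₁
    · rw [Affine.slope_of_X_ne hx, div_eq_iff (sub_ne_zero.2 hx)]
      linear_combination hy₁ - hy₂
  rw [Affine.Point.add_some hxy, Affine.Point.neg_some, Affine.Point.some.injEq]
  have hX : W.addX x₁ x₂ (W.slope x₁ x₂ y₁ y₂) = x₃ := by
    rw [hl, Affine.addX, hW.a₁]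
    linear_combination -e₁
  refine ⟨hX, ?_⟩
  rw [Affine.addY, hX, Affine.negAddY, hX, hl, hW.negY_eq, hW.negY_eq]
  linear_combination -hy₁ + hy₃

/-- Two points that are not opposite lie on a line, which cuts the curve in a third point. -/
theorem exists_collinear (hW : IsTwoTorsionModel W)
    {x₁ y₁ x₂ y₂ : F} (h₁ : W.Nonsingular x₁ y₁) (h₂ : W.Nonsingular x₂ y₂)
    (hxy : ¬ (x₁ = x₂ ∧ y₁ = W.negY x₂ y₂)) :
    ∃ (l n x₃ y₃ : F) (h₃ : W.Nonsingular x₃ y₃), y₁ = l * x₁ + n ∧ y₂ = l * x₂ + n ∧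
      y₃ = l * x₃ + n ∧ x₁ + x₂ + x₃ = l ^ 2 - W.a₂ ∧
      x₁ * x₂ + x₁ * x₃ + x₂ * x₃ = W.a₄ - 2 * l * n ∧ x₁ * x₂ * x₃ = n ^ 2 ∧
      Affine.Point.some x₁ y₁ h₁ + Affine.Point.some x₂ y₂ h₂ =
        -Affine.Point.some x₃ y₃ h₃ := by
  have h := Affine.addPolynomial_slope h₁.1 h₂.1 hxy
  have hy₂ : y₂ = W.slope x₁ x₂ y₁ y₂ * x₂ + (y₁ - W.slope x₁ x₂ y₁ y₂ * x₁) := by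
    by_cases hx : x₁ = x₂
    · have hy : y₁ ≠ W.negY x₂ y₂ := fun h => hxy ⟨hx, h⟩
      have := Affine.Y_eq_of_Y_ne h₁.1 h₂.1 hx hy
      rw [← this, hx]
      ring
    · rw [Affine.slope_of_X_ne hx]
      field_simp [sub_ne_zero.2 hx]
      ring
  -- Comparing coefficients in `addPolynomial` = -(X - x₁)(X - x₂)(X - x₃) yields the three Vieta
  -- relations.
  rw [Affine.addPolynomial_eq, Cubic.prod_X_sub_C_eq, neg_inj, Cubic.toPoly_injective,
    Cubic.mk.injEq, hW.a₁, hW.a₃, hW.a₆] at h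
  obtain ⟨-, hb, hc, hd⟩ := h
  refine ⟨W.slope x₁ x₂ y₁ y₂, y₁ - W.slope x₁ x₂ y₁ y₂ * x₁, _, _,
    Affine.nonsingular_negAdd h₁ h₂ hxy, by ring, hy₂, ?_, ?_, ?_, ?_, ?_⟩
  · rw [Affine.negAddY]
    ring
  · linear_combination hb
  · linear_combination -hc
  · linear_combination hd
  · rw [Affine.Point.add_some hxy]
    rfl

end IsTwoTorsionModel

/-- `W'` is the quotient of `W : y² = x³ + a₂ x² + a₄ x` by the two-torsion point `(0, 0)`, with
coordinates rescaled by `m`. -/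
structure TwoIsogenyData {F : Type} [Field F] (W W' : Affine F) (m : F) : Prop where
  left : IsTwoTorsionModel W
  right : IsTwoTorsionModel W'
  two_ne_zero : (2 : F) ≠ 0
  m_ne_zero : m ≠ 0
  a₄_ne_zero : W.a₄ ≠ 0
  a₂_eq : m ^ 2 * W'.a₂ = -2 * W.a₂
  a₄_eq : m ^ 4 * W'.a₄ = W.a₂ ^ 2 - 4 * W.a₄

namespace TwoIsogenyData

variable {F : Type} [Field F] {W W' : Affine F} {m : F}

theorem a₂_eq_div (h : TwoIsogenyData W W' m) : W'.a₂ = -2 * W.a₂ / m ^ 2 := by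
  rw [eq_div_iff (pow_ne_zero _ h.m_ne_zero)]
  linear_combination h.a₂_eq

theorem a₄_eq_div (h : TwoIsogenyData W W' m) : W'.a₄ = (W.a₂ ^ 2 - 4 * W.a₄) / m ^ 4 := by
  rw [eq_div_iff (pow_ne_zero _ h.m_ne_zero)]
  linear_combination h.a₄_eq

theorem equation (h : TwoIsogenyData W W' m) {x y : F} (hx : x ≠ 0) (hxy : W.Equation x y) :
    W'.Equation (y ^ 2 / (m ^ 2 * x ^ 2)) (y * (x ^ 2 - W.a₄) / (m ^ 3 * x ^ 2)) := by
  rw [h.left.equation_iff] at hxy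
  rw [h.right.equation_iff, h.a₂_eq_div, h.a₄_eq_div]
  have hm := h.m_ne_zero
  field_simp
  -- After clearing denominators the claim is y² ((y² - a₂x²)² - 4a₄x⁴) = y² x² (x² - a₄)². It
  -- follows from y² - a₂x² = x³ + a₄x, and the cofactor comes from a difference of squares.
  linear_combination (-y ^ 2 * (y ^ 2 + x ^ 3 + W.a₄ * x - W.a₂ * x ^ 2)) * hxy

variable [DecidableEq F] [W'.IsElliptic]

/-- The two-isogeny `(x, y) ↦ (y² / (m² x²), y (x² - a₄) / (m³ x²))` on points. -/
def toFun (h : TwoIsogenyData W W' m) : W.Point → W'.Point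
  | 0 => 0
  | Affine.Point.some x _ hxy =>
    if hx : x = 0 then 0 else Affine.Point.mk (h.equation hx hxy.1)

theorem toFun_zero (h : TwoIsogenyData W W' m) : h.toFun 0 = 0 := rfl

theorem toFun_some_of_eq (h : TwoIsogenyData W W' m) {x y : F} (hxy : W.Nonsingular x y)
    (hx : x = 0) : h.toFun (Affine.Point.some x y hxy) = 0 :=
  dif_pos hx

theorem toFun_some (h : TwoIsogenyData W W' m) {x y : F} (hxy : W.Nonsingular x y) (hx : x ≠ 0) :
    h.toFun (Affine.Point.some x y hxy) = Affine.Point.some _ _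
      ((Affine.equation_iff_nonsingular (W := W')).1 (h.equation hx hxy.1)) :=
  dif_neg hx

theorem toFun_neg (h : TwoIsogenyData W W' m) (P : W.Point) : h.toFun (-P) = -h.toFun P := by
  rcases P with _ | ⟨x, y, hxy⟩
  · rfl
  · rw [Affine.Point.neg_some]
    by_cases hx : x = 0
    · rw [h.toFun_some_of_eq _ hx, h.toFun_some_of_eq _ hx, neg_zero]
    · rw [h.toFun_some _ hx, h.toFun_some _ hx, Affine.Point.neg_some, Affine.Point.some.injEq,
        h.left.negY_eq, h.right.negY_eq]
      exact ⟨by ring, by ring⟩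

/-- The two points are collinear with (0, 0), so their sum is the kernel point and their images are
opposite. -/
theorem toFun_eq_neg_of_mul_eq (h : TwoIsogenyData W W' m) {x₁ y₁ x₂ y₂ l : F}
    (h₁ : W.Nonsingular x₁ y₁) (h₂ : W.Nonsingular x₂ y₂) (hx : x₁ * x₂ = W.a₄)
    (hy₁ : y₁ = l * x₁) (hy₂ : y₂ = l * x₂) :
    h.toFun (Affine.Point.some _ _ h₁) = -h.toFun (Affine.Point.some _ _ h₂) := by
  have hx₁ : x₁ ≠ 0 := fun h0 => h.a₄_ne_zero (by rw [← hx, h0, zero_mul])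
  have hx₂ : x₂ ≠ 0 := fun h0 => h.a₄_ne_zero (by rw [← hx, h0, mul_zero])
  have hm := h.m_ne_zero
  rw [h.toFun_some _ hx₁, h.toFun_some _ hx₂, Affine.Point.neg_some, Affine.Point.some.injEq,
    h.right.negY_eq, ← hx, hy₁, hy₂]
  constructor
  · field_simp
  · field_simp
    ring

/-- On a line y = l x + n with n ≠ 0 the function w = y / x equals l + n / x, and the image has X =
w² / m². Vieta's relations for the xᵢ give the symmetric functions of the wᵢ, hence those of the Xᵢ,
and these are the Vieta relations of an explicit line on the target curve. -/
theorem toFun_add_of_collinear (h : TwoIsogenyData W W' m) {x₁ y₁ x₂ y₂ x₃ y₃ l n : F}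
    (h₁ : W.Nonsingular x₁ y₁) (h₂ : W.Nonsingular x₂ y₂)
    (h₃ : W.Nonsingular x₃ y₃) (hy₁ : y₁ = l * x₁ + n) (hy₂ : y₂ = l * x₂ + n)
    (hy₃ : y₃ = l * x₃ + n) (e₁ : x₁ + x₂ + x₃ = l ^ 2 - W.a₂)
    (e₂ : x₁ * x₂ + x₁ * x₃ + x₂ * x₃ = W.a₄ - 2 * l * n) (e₃ : x₁ * x₂ * x₃ = n ^ 2) :
    h.toFun (Affine.Point.some x₁ y₁ h₁) + h.toFun (Affine.Point.some x₂ y₂ h₂) =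
      -h.toFun (Affine.Point.some x₃ y₃ h₃) := by
  by_cases hn : n = 0
  · subst hn
    simp only [add_zero] at hy₁ hy₂ hy₃
    have h0 : (x₁ = 0 ∨ x₂ = 0) ∨ x₃ = 0 := by simpa using e₃
    rcases h0 with (h0 | h0) | h0
    · rw [h.toFun_some_of_eq _ h0, zero_add]
      exact h.toFun_eq_neg_of_mul_eq h₂ h₃ (by rw [h0] at e₂; linear_combination e₂) hy₂ hy₃
    · rw [h.toFun_some_of_eq h₂ h0, add_zero]
      exact h.toFun_eq_neg_of_mul_eq h₁ h₃ (by rw [h0] at e₂; linear_combination e₂) hy₁ hy₃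
    · rw [h.toFun_some_of_eq h₃ h0, neg_zero, ← eq_neg_iff_add_eq_zero]
      exact h.toFun_eq_neg_of_mul_eq h₁ h₂ (by rw [h0] at e₂; linear_combination e₂) hy₁ hy₂
  · have hx : x₁ * x₂ * x₃ ≠ 0 := by rw [e₃]; exact pow_ne_zero 2 hn
    have hx₁ : x₁ ≠ 0 := by rintro rfl; simp at hx
    have hx₂ : x₂ ≠ 0 := by rintro rfl; simp at hx
    have hx₃ : x₃ ≠ 0 := by rintro rfl; simp at hx
    have hm := h.m_ne_zero
    have s₁ : y₁ / x₁ + y₂ / x₂ + y₃ / x₃ = l + W.a₄ / n := by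
      have : y₁ / x₁ + y₂ / x₂ + y₃ / x₃ = 3 * l + n * (x₁ * x₂ + x₁ * x₃ + x₂ * x₃) /
          (x₁ * x₂ * x₃) := by
        rw [hy₁, hy₂, hy₃]
        field_simp
        ring
      rw [this, e₂, e₃]
      field_simp
      ring
    have s₂ : y₁ / x₁ * (y₂ / x₂) + y₁ / x₁ * (y₃ / x₃) + y₂ / x₂ * (y₃ / x₃) =
        2 * l * W.a₄ / n - W.a₂ := by
      have : y₁ / x₁ * (y₂ / x₂) + y₁ / x₁ * (y₃ / x₃) + y₂ / x₂ * (y₃ / x₃) =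
          3 * l ^ 2 + 2 * l * n * (x₁ * x₂ + x₁ * x₃ + x₂ * x₃) / (x₁ * x₂ * x₃) +
          n ^ 2 * (x₁ + x₂ + x₃) / (x₁ * x₂ * x₃) := by
        rw [hy₁, hy₂, hy₃]
        field_simp
        ring
      rw [this, e₁, e₂, e₃]
      field_simp
      ring
    have s₃ : y₁ / x₁ * (y₂ / x₂) * (y₃ / x₃) = l ^ 2 * W.a₄ / n - l * W.a₂ + n := by
      have : y₁ / x₁ * (y₂ / x₂) * (y₃ / x₃) =
          l ^ 3 + l ^ 2 * n * (x₁ * x₂ + x₁ * x₃ + x₂ * x₃) / (x₁ * x₂ * x₃) +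
          l * n ^ 2 * (x₁ + x₂ + x₃) / (x₁ * x₂ * x₃) + n ^ 3 / (x₁ * x₂ * x₃) := by
        rw [hy₁, hy₂, hy₃]
        field_simp
        ring
      rw [this, e₁, e₂, e₃]
      field_simp
      ring
    have hX : ∀ x y : F, x ≠ 0 → y ^ 2 / (m ^ 2 * x ^ 2) = (y / x) ^ 2 / m ^ 2 := by
      intro x y hx
      field_simp
    -- The image line: Y is the same affine function of X at all three points.
    have hY : ∀ x y : F, x ≠ 0 → W.Equation x y → y = l * x + n →
        y * (x ^ 2 - W.a₄) / (m ^ 3 * x ^ 2) = (l - W.a₄ / n) / m * (y ^ 2 / (m ^ 2 * x ^ 2)) +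
          (l ^ 2 * W.a₄ / n + n - l * W.a₂) / m ^ 3 := by
      intro x y hx hxy hy
      rw [h.left.equation_iff] at hxy
      field_simp
      linear_combination (W.a₄ * y + l * W.a₄ * x + n * x ^ 2) * hy - l * n * hxy
    rw [h.toFun_some _ hx₁, h.toFun_some _ hx₂, h.toFun_some _ hx₃]
    refine h.right.add_eq_neg_of_collinear h.two_ne_zero _ _ _ (hY _ _ hx₁ h₁.1 hy₁)
      (hY _ _ hx₂ h₂.1 hy₂) (hY _ _ hx₃ h₃.1 hy₃) ?_ ?_ ?_
    · rw [hX _ _ hx₁, hX _ _ hx₂, hX _ _ hx₃, h.a₂_eq_div]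
      generalize y₁ / x₁ = w₁ at s₁ s₂ s₃ ⊢
      generalize y₂ / x₂ = w₂ at s₁ s₂ s₃ ⊢
      generalize y₃ / x₃ = w₃ at s₁ s₂ s₃ ⊢
      have : w₁ ^ 2 / m ^ 2 + w₂ ^ 2 / m ^ 2 + w₃ ^ 2 / m ^ 2 = ((w₁ + w₂ + w₃) ^ 2 -
          2 * (w₁ * w₂ + w₁ * w₃ + w₂ * w₃)) / m ^ 2 := by ring
      rw [this, s₁, s₂]
      field_simp
      ring
    · rw [hX _ _ hx₁, hX _ _ hx₂, hX _ _ hx₃, h.a₄_eq_div]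
      generalize y₁ / x₁ = w₁ at s₁ s₂ s₃ ⊢
      generalize y₂ / x₂ = w₂ at s₁ s₂ s₃ ⊢
      generalize y₃ / x₃ = w₃ at s₁ s₂ s₃ ⊢
      have : w₁ ^ 2 / m ^ 2 * (w₂ ^ 2 / m ^ 2) + w₁ ^ 2 / m ^ 2 * (w₃ ^ 2 / m ^ 2) +
          w₂ ^ 2 / m ^ 2 * (w₃ ^ 2 / m ^ 2) = ((w₁ * w₂ + w₁ * w₃ + w₂ * w₃) ^ 2 -
          2 * (w₁ + w₂ + w₃) * (w₁ * w₂ * w₃)) / m ^ 4 := by ring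
      rw [this, s₁, s₂, s₃]
      field_simp
      ring
    · rw [hX _ _ hx₁, hX _ _ hx₂, hX _ _ hx₃]
      generalize y₁ / x₁ = w₁ at s₁ s₂ s₃ ⊢
      generalize y₂ / x₂ = w₂ at s₁ s₂ s₃ ⊢
      generalize y₃ / x₃ = w₃ at s₁ s₂ s₃ ⊢
      have : w₁ ^ 2 / m ^ 2 * (w₂ ^ 2 / m ^ 2) * (w₃ ^ 2 / m ^ 2) =
          (w₁ * w₂ * w₃) ^ 2 / m ^ 6 := by ring
      rw [this, s₃]
      field_simp
      ring

theorem toFun_add (h : TwoIsogenyData W W' m) (P Q : W.Point) :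
    h.toFun (P + Q) = h.toFun P + h.toFun Q := by
  rcases P with _ | ⟨x₁, y₁, h₁⟩
  · rw [← Affine.Point.zero_def, zero_add, h.toFun_zero, zero_add]
  rcases Q with _ | ⟨x₂, y₂, h₂⟩
  · rw [← Affine.Point.zero_def, add_zero, h.toFun_zero, add_zero]
  by_cases hxy : x₁ = x₂ ∧ y₁ = W.negY x₂ y₂
  · have h0 : Affine.Point.some x₁ y₁ h₁ + Affine.Point.some x₂ y₂ h₂ = 0 :=
      Affine.Point.add_of_Y_eq hxy.1 hxy.2
    rw [h0, h.toFun_zero, eq_neg_of_add_eq_zero_left h0, h.toFun_neg, neg_add_cancel]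
  · obtain ⟨l, n, x₃, y₃, h₃, hy₁, hy₂, hy₃, e₁, e₂, e₃, hs⟩ :=
      h.left.exists_collinear h₁ h₂ hxy
    rw [hs, h.toFun_neg, h.toFun_add_of_collinear h₁ h₂ h₃ hy₁ hy₂ hy₃ e₁ e₂ e₃]

/-- The two-isogeny as a homomorphism of the groups of points. -/
def toAddMonoidHom (h : TwoIsogenyData W W' m) : W.Point →+ W'.Point where
  toFun := h.toFun
  map_zero' := h.toFun_zero
  map_add' := h.toFun_add

theorem toFun_eq_zero_iff (h : TwoIsogenyData W W' m) {T : W.Point} {h0 : W.Nonsingular 0 0}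
    (hT : T = Affine.Point.some 0 0 h0) (P : W.Point) : h.toFun P = 0 ↔ P = 0 ∨ P = T := by
  subst hT
  rcases P with _ | ⟨x, y, hxy⟩
  · simp [← Affine.Point.zero_def, h.toFun_zero]
  · by_cases hx : x = 0
    · subst hx
      have hy : y = 0 := by simpa [h.left.equation_iff] using hxy.1
      subst hy
      simp [h.toFun_some_of_eq]
    · rw [h.toFun_some _ hx]
      simp [hx]

/-- The composition with the dual isogeny is multiplication by two. -/
theorem toFun_toFun [W.IsElliptic] {m' : F} (h : TwoIsogenyData W W' m)
    (h' : TwoIsogenyData W' W m') (hm : m * m' = 2) (P : W.Point) :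
    h'.toFun (h.toFun P) = 2 • P := by
  rcases P with _ | ⟨x, y, hxy⟩
  · rw [← Affine.Point.zero_def, h.toFun_zero, h'.toFun_zero, smul_zero]
  have heq := h.left.equation_iff.1 hxy.1
  have hm0 := h.m_ne_zero
  have hm0' := h'.m_ne_zero
  have h2 := h.two_ne_zero
  have hm' : m' = 2 / m := by field_simp; linear_combination hm
  by_cases hy : y = 0
  · have hP : 2 • Affine.Point.some x y hxy = 0 := by
      rw [two_nsmul]
      exact Affine.Point.add_self_of_Y_eq (by rw [h.left.negY_eq, hy, neg_zero])
    rw [hP]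
    by_cases hx : x = 0
    · rw [h.toFun_some_of_eq _ hx, h'.toFun_zero]
    · rw [h.toFun_some _ hx, h'.toFun_some_of_eq]
      rw [hy]
      simp
  · have hx : x ≠ 0 := by
      rintro rfl
      exact hy (by simpa using heq)
    have hX : y ^ 2 / (m ^ 2 * x ^ 2) ≠ 0 := by positivity
    have hne : y ≠ W.negY x y := by
      rw [h.left.negY_eq]
      intro e
      exact hy (by simpa [h2] using (by linear_combination e : 2 * y = 0))
    have ha₄ : W'.a₄ = (W.a₂ ^ 2 - 4 * W.a₄) / m ^ 4 := h.a₄_eq_div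
    have hyy : y - -y ≠ 0 := by rwa [h.left.negY_eq, ← sub_ne_zero] at hne
    have hyy : y + y ≠ 0 := by rwa [sub_neg_eq_add] at hyy
    rw [h.toFun_some _ hx, h'.toFun_some _ hX, two_nsmul, Affine.Point.add_self_of_Y_ne hne,
      Affine.Point.some.injEq]
    have hslope : W.slope x x y y = (3 * x ^ 2 + 2 * W.a₂ * x + W.a₄) / (2 * y) := by
      rw [Affine.slope_of_Y_ne rfl hne, h.left.negY_eq, h.left.a₁]
      congr 1 <;> ring
    -- Eliminating a₂ by the curve equation turns both coordinates into rational identities in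
    -- independent x, y, a₄ and m.
    have hb : W.a₂ = (y ^ 2 - x ^ 3 - W.a₄ * x) / x ^ 2 := by
      field_simp
      linear_combination -heq
    rw [Affine.addY, Affine.negAddY, Affine.addX, hslope, h.left.negY_eq, h.left.a₁, hm', ha₄, hb]
    constructor
    · field_simp
      ring
    · field_simp
      ring

end TwoIsogenyData

end KummerSandwich

end

noncomputable section

namespace KummerSandwich

open Polynomial
open scoped Polynomial.Bivariate Classical

/-! ## The function field of the generic fibre -/

namespace TwoTorsionK3

variable (S : TwoTorsionK3)

theorem isTwoTorsionModel_baseChange (L : Type) [Field L] [Algebra BaseField L] :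
    IsTwoTorsionModel (S.genericFibre.baseChange L) where
  a₁ := by simp [genericFibre]
  a₃ := by simp [genericFibre]
  a₆ := by simp [genericFibre]

/-- The coefficient `A`, as an element of a field over `ℂ(v)`. -/
def coeffA (L : Type) [Field L] [Algebra BaseField L] : L :=
  algebraMap BaseField L (algebraMap ℂ[X] BaseField S.A)

/-- The coefficient `B`, as an element of a field over `ℂ(v)`. -/
def coeffB (L : Type) [Field L] [Algebra BaseField L] : L :=
  algebraMap BaseField L (algebraMap ℂ[X] BaseField S.B)

theorem coeffB_ne_zero (L : Type) [Field L] [Algebra BaseField L] : S.coeffB L ≠ 0 := by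
  simpa [coeffB] using S.B_ne_zero

theorem equation_iff {L : Type} [Field L] [Algebra BaseField L] {a b : L} :
    (S.genericFibre.baseChange L).Equation a b ↔
      b ^ 2 = a ^ 3 + S.coeffA L * a ^ 2 + S.coeffB L * a :=
  (S.isTwoTorsionModel_baseChange L).equation_iff

/-- Evaluation at `(a, b)` of polynomials over `ℂ(v)`. -/
def valueHom {L : Type} [Field L] [Algebra BaseField L] (a b : L) : BaseField[X][Y] →+* L :=
  (evalEvalRingHom a b).comp (mapRingHom (mapRingHom (algebraMap BaseField L)))

theorem valueHom_apply {L : Type} [Field L] [Algebra BaseField L] (a b : L)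
    (r : BaseField[X][Y]) : valueHom a b r = value r a b := rfl

@[simp]
theorem valueHom_C_C {L : Type} [Field L] [Algebra BaseField L] (a b : L) (c : BaseField) :
    valueHom a b (C (C c)) = algebraMap BaseField L c := by
  simp [valueHom]

@[simp]
theorem valueHom_C_X {L : Type} [Field L] [Algebra BaseField L] (a b : L) :
    valueHom a b (C X) = a := by
  simp [valueHom]

@[simp]
theorem valueHom_Y {L : Type} [Field L] [Algebra BaseField L] (a b : L) :
    valueHom a b Y = b := by
  simp [valueHom]

theorem valueHom_polynomial {L : Type} [Field L] [Algebra BaseField L] {a b : L}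
    (h : (S.genericFibre.baseChange L).Equation a b) :
    valueHom a b S.genericFibre.polynomial = 0 := by
  rw [S.equation_iff] at h
  simp only [WeierstrassCurve.Affine.polynomial, map_add, map_sub, map_mul, map_pow, valueHom_C_C,
    valueHom_C_X, valueHom_Y]
  simp only [genericFibre, map_zero]
  unfold coeffA coeffB at h
  linear_combination h

theorem value_C {L : Type} [Field L] [Algebra BaseField L] (a b : L) (p : BaseField[X]) :
    value (C p) a b = aeval a p := by
  rw [value, map_C, coe_mapRingHom, evalEval_C, eval_map_algebraMap]

/-- Evaluation at a point of the curve, on the coordinate ring. -/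
def evalHom {L : Type} [Field L] [Algebra BaseField L] {a b : L}
    (h : (S.genericFibre.baseChange L).Equation a b) :
    S.genericFibre.CoordinateRing →ₐ[BaseField] L where
  __ := Ideal.Quotient.lift _ (valueHom a b) (by
    intro p hp
    obtain ⟨q, rfl⟩ := Ideal.mem_span_singleton.1 hp
    rw [map_mul, S.valueHom_polynomial h, zero_mul])
  commutes' := fun c => valueHom_C_C a b c

theorem evalHom_mk {L : Type} [Field L] [Algebra BaseField L] {a b : L}
    (h : (S.genericFibre.baseChange L).Equation a b) (r : BaseField[X][Y]) :
    S.evalHom h (WeierstrassCurve.Affine.CoordinateRing.mk S.genericFibre r) = value r a b := rfl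

/-- The coordinate ring is a domain finite over ℂ(v)[X], so an ideal that meets ℂ(v)[X] trivially is
zero. An element of the kernel in ℂ(v)[X] is a polynomial relation for a. -/
theorem evalHom_injective {L : Type} [Field L] [Algebra BaseField L] {a b : L}
    (h : (S.genericFibre.baseChange L).Equation a b) (ha : Transcendental BaseField a) :
    Function.Injective (S.evalHom h) := by
  have : Module.Finite BaseField[X] S.genericFibre.CoordinateRing :=
    Module.Finite.of_basis (WeierstrassCurve.Affine.CoordinateRing.basis S.genericFibre)
  rw [← AlgHom.coe_toRingHom, RingHom.injective_iff_ker_eq_bot]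
  refine Ideal.eq_bot_of_comap_eq_bot (R := BaseField[X]) ?_
  rw [eq_bot_iff]
  intro p hp
  have h0 : S.evalHom h (WeierstrassCurve.Affine.CoordinateRing.mk S.genericFibre (C p)) = 0 := hp
  rw [evalHom_mk, value_C] at h0
  by_contra hne
  exact ha ⟨p, hne, h0⟩

/-- The homomorphism from the function field that is given by a point with transcendental
`x`-coordinate. -/
def liftHom {L : Type} [Field L] [Algebra BaseField L] {a b : L}
    (h : (S.genericFibre.baseChange L).Equation a b) (ha : Transcendental BaseField a) :
    S.FunctionField →ₐ[BaseField] L :=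
  IsFractionRing.liftAlgHom (R := BaseField) (A := S.genericFibre.CoordinateRing)
    (K := S.FunctionField) (g := S.evalHom h) (S.evalHom_injective h ha)

theorem liftHom_ratio {L : Type} [Field L] [Algebra BaseField L] {a b : L}
    (h : (S.genericFibre.baseChange L).Equation a b) (ha : Transcendental BaseField a)
    (r d : BaseField[X][Y]) : S.liftHom h ha (S.ratio r d) = value r a b / value d a b := by
  have key : ∀ f : S.genericFibre.CoordinateRing,
      S.liftHom h ha (algebraMap _ _ f) = S.evalHom h f := fun f =>
    IsFractionRing.lift_algebraMap (S.evalHom_injective h ha) f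
  rw [ratio, map_div₀, key, key, evalHom_mk, evalHom_mk]

theorem value_one {L : Type} [Field L] [Algebra BaseField L] (a b : L) :
    value (1 : BaseField[X][Y]) a b = 1 := map_one (valueHom a b)

theorem liftHom_x {L : Type} [Field L] [Algebra BaseField L] {a b : L}
    (h : (S.genericFibre.baseChange L).Equation a b) (ha : Transcendental BaseField a) :
    S.liftHom h ha S.x = a := by
  rw [x, liftHom_ratio, value_one, div_one]
  exact valueHom_C_X a b

theorem liftHom_y {L : Type} [Field L] [Algebra BaseField L] {a b : L}
    (h : (S.genericFibre.baseChange L).Equation a b) (ha : Transcendental BaseField a) :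
    S.liftHom h ha S.y = b := by
  rw [y, liftHom_ratio, value_one, div_one]
  exact valueHom_Y a b

theorem algebraMap_mk (r : BaseField[X][Y]) :
    algebraMap S.genericFibre.CoordinateRing S.FunctionField
      (WeierstrassCurve.Affine.CoordinateRing.mk S.genericFibre r) = value r S.x S.y := by
  have : (algebraMap S.genericFibre.CoordinateRing S.FunctionField).comp
      (WeierstrassCurve.Affine.CoordinateRing.mk S.genericFibre) = valueHom S.x S.y := by
    ext c
    · simp only [RingHom.comp_apply, valueHom_C_C]
      exact (IsScalarTower.algebraMap_apply BaseField S.genericFibre.CoordinateRing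
        S.FunctionField _).symm
    · simp [x, ratio]
    · simp [y, ratio]
  exact RingHom.congr_fun this r

theorem ratio_eq (r d : BaseField[X][Y]) :
    S.ratio r d = value r S.x S.y / value d S.x S.y := by
  rw [ratio, algebraMap_mk, algebraMap_mk]

theorem exists_ratio (f : S.FunctionField) : ∃ r d : BaseField[X][Y],
    value d S.x S.y ≠ 0 ∧ f = value r S.x S.y / value d S.x S.y := by
  obtain ⟨a, b, hb, rfl⟩ := IsFractionRing.div_surjective (A := S.genericFibre.CoordinateRing) f
  obtain ⟨r, rfl⟩ := Ideal.Quotient.mk_surjective a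
  obtain ⟨d, rfl⟩ := Ideal.Quotient.mk_surjective b
  refine ⟨r, d, ?_, ?_⟩
  · rw [← algebraMap_mk]
    exact IsFractionRing.to_map_ne_zero_of_mem_nonZeroDivisors hb
  · rw [← algebraMap_mk, ← algebraMap_mk]
    rfl

/-- Relations between polynomials in the generic point hold at all points. -/
theorem value_eq_of_value_genericPoint_eq {L : Type} [Field L] [Algebra BaseField L] {a b : L}
    (h : (S.genericFibre.baseChange L).Equation a b) {r r' : BaseField[X][Y]}
    (hr : value r S.x S.y = value r' S.x S.y) : value r a b = value r' a b := by
  rw [← algebraMap_mk, ← algebraMap_mk] at hr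
  rw [← S.evalHom_mk h, ← S.evalHom_mk h,
    IsFractionRing.injective S.genericFibre.CoordinateRing S.FunctionField hr]

theorem transcendental_x : Transcendental BaseField S.x := by
  rintro ⟨p, hp, h⟩
  rw [← value_C S.x S.y, ← algebraMap_mk] at h
  have h2 := (FaithfulSMul.algebraMap_eq_zero_iff S.genericFibre.CoordinateRing
    S.FunctionField).1 h
  have h3 : algebraMap BaseField[X] S.genericFibre.CoordinateRing p = 0 := h2
  exact hp ((FaithfulSMul.algebraMap_eq_zero_iff _ _).1 h3)

theorem y_sq : S.y ^ 2 = S.x ^ 3 + S.coeffA S.FunctionField * S.x ^ 2 +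
    S.coeffB S.FunctionField * S.x :=
  S.equation_iff.1 S.equation_genericPoint

theorem x_ne_zero : S.x ≠ 0 := fun h =>
  S.transcendental_x (h ▸ isAlgebraic_zero)

theorem y_ne_zero : S.y ≠ 0 := by
  intro h
  have h1 := S.y_sq
  rw [h] at h1
  have h2 : S.x ^ 2 + S.coeffA S.FunctionField * S.x + S.coeffB S.FunctionField = 0 := by
    have : S.x * (S.x ^ 2 + S.coeffA S.FunctionField * S.x + S.coeffB S.FunctionField) = 0 := by
      linear_combination -h1
    simpa [S.x_ne_zero] using this
  refine S.transcendental_x ⟨X ^ 2 + C (algebraMap ℂ[X] BaseField S.A) * X +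
    C (algebraMap ℂ[X] BaseField S.B), ?_, ?_⟩
  · exact Monic.ne_zero (by monicity!)
  · simpa [coeffA, coeffB] using h2

/-- The function field is generated by `x` and `y` over `ℂ(v)`. -/
theorem mem_of_x_mem_of_y_mem (L : Subfield S.FunctionField)
    (hc : ∀ c, algebraMap BaseField S.FunctionField c ∈ L) (hx : S.x ∈ L) (hy : S.y ∈ L)
    (f : S.FunctionField) : f ∈ L := by
  have key : ∀ r : BaseField[X][Y], value r S.x S.y ∈ L := by
    intro r
    induction r using Polynomial.induction_on' with
    | add p q hp hq =>
      rw [← valueHom_apply, map_add]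
      exact L.add_mem hp hq
    | monomial n p =>
      rw [← valueHom_apply, ← C_mul_X_pow_eq_monomial, map_mul, map_pow, valueHom_Y]
      refine L.mul_mem ?_ (L.pow_mem hy n)
      induction p using Polynomial.induction_on' with
      | add p q hp hq =>
        rw [map_add, map_add]
        exact L.add_mem hp hq
      | monomial k c =>
        rw [← C_mul_X_pow_eq_monomial, map_mul, map_pow, map_mul, map_pow, valueHom_C_X,
          valueHom_C_C]
        exact L.mul_mem (hc c) (L.pow_mem hx k)
  obtain ⟨r, d, -, rfl⟩ := S.exists_ratio f
  exact L.div_mem (key r) (key d)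

/-- The function field is generated by `v`, `x` and `y` over `ℂ`. -/
theorem mem_of_v_mem (L : Subfield S.FunctionField)
    (hc : ∀ c : ℂ, algebraMap ℂ S.FunctionField c ∈ L) (hv : S.v ∈ L) (hx : S.x ∈ L)
    (hy : S.y ∈ L) (f : S.FunctionField) : f ∈ L := by
  refine S.mem_of_x_mem_of_y_mem L (fun c => ?_) hx hy f
  have key : ∀ p : ℂ[X], algebraMap BaseField S.FunctionField (algebraMap ℂ[X] BaseField p) ∈ L := by
    intro p
    induction p using Polynomial.induction_on' with
    | add p q hp hq =>
      rw [map_add, map_add]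
      exact L.add_mem hp hq
    | monomial k c =>
      rw [← C_mul_X_pow_eq_monomial, map_mul, map_pow, map_mul, map_pow, RatFunc.algebraMap_X,
        RatFunc.algebraMap_C]
      refine L.mul_mem ?_ (L.pow_mem hv k)
      have h := hc c
      rwa [IsScalarTower.algebraMap_apply ℂ BaseField S.FunctionField] at h
  induction c using RatFunc.induction_on with
  | f p q hq =>
    rw [map_div₀]
    exact L.div_mem (key p) (key q)

theorem algHom_ext {K : Type} [Field K] [Algebra BaseField K]
    {φ ψ : S.FunctionField →ₐ[BaseField] K} (hx : φ S.x = ψ S.x) (hy : φ S.y = ψ S.y) : φ = ψ :=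
  AlgHom.ext fun f =>
    S.mem_of_x_mem_of_y_mem (RingHom.eqLocusField φ.toRingHom ψ.toRingHom)
      (fun c => by
        change φ _ = ψ _
        rw [φ.commutes, ψ.commutes]) hx hy f

end TwoTorsionK3

/-! ### Fixed fields of quadratic extensions -/

/-- Let `K = L + L w` with `w² ∈ L`. Then the fixed field of an automorphism of `K` over `L` with
`w ↦ -w` is `L`. -/
theorem mem_of_fixed {K : Type} [Field K] (h2 : (2 : K) ≠ 0) (L : Subfield K) {w : K}
    (hw0 : w ≠ 0) (hw : w ^ 2 ∈ L)
    (hgen : ∀ M : Subfield K, L ≤ M → w ∈ M → ∀ f, f ∈ M) (σ : K →+* K)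
    (hσ : ∀ a ∈ L, σ a = a) (hσw : σ w = -w) {f : K} (hf : σ f = f) : f ∈ L := by
  let M : Subfield K :=
    { carrier := {f | ∃ a ∈ L, ∃ b ∈ L, f = a + b * w}
      zero_mem' := ⟨0, L.zero_mem, 0, L.zero_mem, by ring⟩
      one_mem' := ⟨1, L.one_mem, 0, L.zero_mem, by ring⟩
      add_mem' := by
        rintro _ _ ⟨a, ha, b, hb, rfl⟩ ⟨c, hc, d, hd, rfl⟩
        exact ⟨a + c, L.add_mem ha hc, b + d, L.add_mem hb hd, by ring⟩
      neg_mem' := by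
        rintro _ ⟨a, ha, b, hb, rfl⟩
        exact ⟨-a, L.neg_mem ha, -b, L.neg_mem hb, by ring⟩
      mul_mem' := by
        rintro _ _ ⟨a, ha, b, hb, rfl⟩ ⟨c, hc, d, hd, rfl⟩
        exact ⟨a * c + b * d * w ^ 2, L.add_mem (L.mul_mem ha hc) (L.mul_mem (L.mul_mem hb hd) hw),
          a * d + b * c, L.add_mem (L.mul_mem ha hd) (L.mul_mem hb hc), by ring⟩
      inv_mem' := by
        rintro _ ⟨a, ha, b, hb, rfl⟩
        -- The inverse is formed with the conjugate a - b w. If the conjugate vanishes, then b w = a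
        -- and the element is 2a, already in L.
        by_cases h : a - b * w = 0
        · refine ⟨(2 * a)⁻¹, L.inv_mem (L.mul_mem (ofNat_mem L 2) ha), 0, L.zero_mem, ?_⟩
          rw [show b * w = a by linear_combination -h]
          ring
        · by_cases h' : a + b * w = 0
          · exact ⟨0, L.zero_mem, 0, L.zero_mem, by rw [h']; simp⟩
          · have hN : a ^ 2 - b ^ 2 * w ^ 2 ∈ L :=
              L.sub_mem (L.pow_mem ha 2) (L.mul_mem (L.pow_mem hb 2) hw)
            have hN0 : a ^ 2 - b ^ 2 * w ^ 2 ≠ 0 := by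
              rw [show a ^ 2 - b ^ 2 * w ^ 2 = (a - b * w) * (a + b * w) by ring]
              exact mul_ne_zero h h'
            refine ⟨a / (a ^ 2 - b ^ 2 * w ^ 2), L.div_mem ha hN,
              -b / (a ^ 2 - b ^ 2 * w ^ 2), L.div_mem (L.neg_mem hb) hN, ?_⟩
            field_simp
            ring }
  obtain ⟨a, ha, b, hb, rfl⟩ := hgen M (fun a ha => ⟨a, ha, 0, L.zero_mem, by ring⟩)
    ⟨0, L.zero_mem, 1, L.one_mem, by ring⟩ f
  rw [map_add, map_mul, hσ a ha, hσ b hb, hσw] at hf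
  have h3 : 2 * b * w = 0 := by linear_combination -hf
  have hb0 : b = 0 := by simpa [h2, hw0] using h3
  rwa [hb0, zero_mul, add_zero]

end KummerSandwich

end

noncomputable section

namespace KummerSandwich

open Polynomial
open scoped Polynomial.Bivariate Classical

namespace TwoTorsionK3

variable (S : TwoTorsionK3)

/-! ## Translation by the two-torsion section -/

theorem isAlgebraic_algebraMap_div {L : Type} [Field L] [Algebra BaseField L] (c : BaseField)
    {a : L} (ha : IsAlgebraic BaseField a) : IsAlgebraic BaseField (algebraMap BaseField L c / a) := by
  rw [div_eq_mul_inv]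
  exact (isAlgebraic_algebraMap c).mul ha.inv

theorem transcendental_translate :
    Transcendental BaseField (S.coeffB S.FunctionField / S.x) := fun h => by
  have h1 := isAlgebraic_algebraMap_div (algebraMap ℂ[X] BaseField S.B) h
  refine S.transcendental_x ?_
  have h2 : S.coeffB S.FunctionField / (S.coeffB S.FunctionField / S.x) = S.x := by
    field_simp [S.coeffB_ne_zero S.FunctionField]
  rw [← h2]
  exact h1

theorem equation_translate : (S.genericFibre.baseChange S.FunctionField).Equation
    (S.coeffB S.FunctionField / S.x) (-(S.coeffB S.FunctionField * S.y / S.x ^ 2)) := by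
  rw [S.equation_iff]
  have := S.x_ne_zero
  field_simp
  linear_combination S.coeffB S.FunctionField ^ 2 * S.y_sq

/-- The comorphism of translation by `T` maps `x` to `B / x` and `y` to `-B y / x²`. -/
def translateHom : S.FunctionField →ₐ[BaseField] S.FunctionField :=
  S.liftHom S.equation_translate S.transcendental_translate

theorem translateHom_x : S.translateHom S.x = S.coeffB S.FunctionField / S.x :=
  S.liftHom_x _ _

theorem translateHom_y :
    S.translateHom S.y = -(S.coeffB S.FunctionField * S.y / S.x ^ 2) :=
  S.liftHom_y _ _

theorem translateHom_coeffB :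
    S.translateHom (S.coeffB S.FunctionField) = S.coeffB S.FunctionField :=
  S.translateHom.commutes _

theorem translateHom_comp : S.translateHom.comp S.translateHom = AlgHom.id _ _ := by
  have hx := S.x_ne_zero
  have hB := S.coeffB_ne_zero S.FunctionField
  apply S.algHom_ext
  · rw [AlgHom.comp_apply, translateHom_x, map_div₀, translateHom_coeffB, translateHom_x,
      AlgHom.id_apply]
    field_simp
  · rw [AlgHom.comp_apply, translateHom_y, map_neg, map_div₀, map_mul, map_pow,
      translateHom_coeffB, translateHom_x, translateHom_y, AlgHom.id_apply]
    field_simp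

/-- Translation by `T`, as an automorphism of the function field. -/
def translate : S.FunctionField ≃ₐ[BaseField] S.FunctionField :=
  AlgEquiv.ofAlgHom S.translateHom S.translateHom S.translateHom_comp S.translateHom_comp

/-- The chord from the generic point to T has slope y / x, and (y / x)² - A - x = B / x by the curve
equation. -/
theorem isTranslation_translate : S.IsTranslation S.translate := by
  have hx := S.x_ne_zero
  have hW := S.isTwoTorsionModel_baseChange S.FunctionField
  have hA : (S.genericFibre.baseChange S.FunctionField).a₂ = S.coeffA S.FunctionField := rfl
  unfold IsTranslation genericPoint T WeierstrassCurve.Affine.Point.mk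
  rw [WeierstrassCurve.Affine.Point.map_some, WeierstrassCurve.Affine.Point.add_of_X_ne hx,
    WeierstrassCurve.Affine.Point.some.injEq, WeierstrassCurve.Affine.addY,
    WeierstrassCurve.Affine.negAddY, WeierstrassCurve.Affine.addX,
    WeierstrassCurve.Affine.slope_of_X_ne hx, hW.negY_eq, hW.a₁, hA]
  have h1 : (S.translate : S.FunctionField →ₐ[BaseField] S.FunctionField) S.x =
    S.coeffB S.FunctionField / S.x := S.translateHom_x
  have h2 : (S.translate : S.FunctionField →ₐ[BaseField] S.FunctionField) S.y =
    -(S.coeffB S.FunctionField * S.y / S.x ^ 2) := S.translateHom_y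
  have h := S.y_sq
  rw [h1, h2]
  have e : ((S.y - 0) / (S.x - 0)) ^ 2 + 0 * ((S.y - 0) / (S.x - 0)) - S.coeffA S.FunctionField -
      S.x - 0 = S.coeffB S.FunctionField / S.x := by
    simp only [sub_zero, zero_mul, add_zero]
    field_simp
    linear_combination h
  refine ⟨e.symm, ?_⟩
  rw [e]
  simp only [sub_zero]
  field_simp
  ring

theorem T_ne_zero (L : Type) [Field L] [Algebra BaseField L] : S.T L ≠ 0 :=
  WeierstrassCurve.Affine.Point.some_ne_zero _

theorem two_nsmul_T (L : Type) [Field L] [Algebra BaseField L] : 2 • S.T L = 0 := by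
  rw [two_nsmul]
  refine WeierstrassCurve.Affine.Point.add_self_of_Y_eq ?_
  rw [(S.isTwoTorsionModel_baseChange L).negY_eq, neg_zero]

theorem addOrderOf_T (L : Type) [Field L] [Algebra BaseField L] : addOrderOf (S.T L) = 2 :=
  addOrderOf_eq_prime (S.two_nsmul_T L) (S.T_ne_zero L)

/-! ## Two-forms -/

/-- The derivation `g ↦ dv ∧ dg`. -/
def wedgeV : Derivation ℂ S.FunctionField (⋀[S.FunctionField]^2 Ω[S.FunctionField⁄ℂ]) :=
  ((exteriorPower.ιMulti S.FunctionField 2 (M := Ω[S.FunctionField⁄ℂ])).toMultilinearMap.toLinearMap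
    ![KaehlerDifferential.D ℂ S.FunctionField S.v, 0] 1).compDer
      (KaehlerDifferential.D ℂ S.FunctionField)

theorem wedgeV_apply (g : S.FunctionField) : S.wedgeV g = dWedge S.v g := by
  change exteriorPower.ιMulti S.FunctionField 2 (Function.update _ 1 _) = _
  rw [dWedge]
  congr 1
  funext i
  fin_cases i <;> simp

theorem wedgeV_v : S.wedgeV S.v = 0 := by
  rw [wedgeV_apply, dWedge]
  exact (exteriorPower.ιMulti S.FunctionField 2).map_eq_zero_of_eq _ (i := 0) (j := 1) rfl
    (by decide)

/-- The differential of a function of v alone is a multiple of dv. Coefficients from the base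
therefore act as constants under `wedgeV`, and two-forms can be computed fibrewise. -/
theorem wedgeV_algebraMap (c : BaseField) : S.wedgeV (algebraMap BaseField S.FunctionField c) = 0 := by
  have key : ∀ p : ℂ[X],
      S.wedgeV (algebraMap BaseField S.FunctionField (algebraMap ℂ[X] BaseField p)) = 0 := by
    intro p
    induction p using Polynomial.induction_on' with
    | add p q hp hq => rw [map_add, map_add, map_add, hp, hq, add_zero]
    | monomial k c =>
      rw [← C_mul_X_pow_eq_monomial, map_mul, map_pow, map_mul, map_pow, RatFunc.algebraMap_X,
        RatFunc.algebraMap_C]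
      change S.wedgeV (_ * S.v ^ k) = 0
      rw [Derivation.leibniz, Derivation.leibniz_pow, wedgeV_v]
      have h : S.wedgeV (algebraMap BaseField S.FunctionField (RatFunc.C c)) = 0 :=
        S.wedgeV.map_algebraMap c
      rw [h]
      simp
  induction c using RatFunc.induction_on with
  | f p q hq =>
    rw [map_div₀, Derivation.leibniz_div, key, key]
    simp

theorem wedgeV_coeffB_div :
    S.wedgeV (S.coeffB S.FunctionField / S.x) =
      (-(S.coeffB S.FunctionField / S.x ^ 2)) • S.wedgeV S.x := by
  have hx := S.x_ne_zero
  rw [Derivation.leibniz_div, coeffB, wedgeV_algebraMap]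
  match_scalars
  field_simp

/-- Modulo dv, dx goes to -B / x² dx, and y is multiplied by -B / x² as well, so dv ∧ dx / y is
preserved. The automorphism is not the identity, since x = B / x would make x algebraic over ℂ(v).
-/
theorem isNikulinInvolution_translate :
    S.IsNikulinInvolution (S.translate.restrictScalars ℂ) := by
  have hx := S.x_ne_zero
  have hy := S.y_ne_zero
  have hB := S.coeffB_ne_zero S.FunctionField
  constructor
  · apply orderOf_eq_prime
    · ext f
      exact DFunLike.congr_fun S.translateHom_comp f
    · intro h
      have h1 : S.translateHom S.x = S.x := DFunLike.congr_fun h S.x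
      rw [translateHom_x, div_eq_iff hx] at h1
      refine S.transcendental_x ⟨X ^ 2 - C (algebraMap ℂ[X] BaseField S.B), ?_, ?_⟩
      · exact Monic.ne_zero (by monicity!)
      · simp only [map_sub, map_pow, aeval_X, aeval_C]
        change S.x ^ 2 - S.coeffB S.FunctionField = 0
        linear_combination -h1
  · have h1 : ((S.translate.restrictScalars ℂ : S.FunctionField ≃ₐ[ℂ] S.FunctionField) :
        S.FunctionField →ₐ[ℂ] S.FunctionField) S.x = S.coeffB S.FunctionField / S.x :=
      S.translateHom_x
    have h2 : ((S.translate.restrictScalars ℂ : S.FunctionField ≃ₐ[ℂ] S.FunctionField) :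
        S.FunctionField →ₐ[ℂ] S.FunctionField) S.y⁻¹ =
        (-(S.coeffB S.FunctionField * S.y / S.x ^ 2))⁻¹ := by
      rw [map_inv₀]
      exact congrArg _ S.translateHom_y
    have h3 : ((S.translate.restrictScalars ℂ : S.FunctionField ≃ₐ[ℂ] S.FunctionField) :
        S.FunctionField →ₐ[ℂ] S.FunctionField) S.v = S.v :=
      S.translateHom.commutes _
    rw [twoForm, pullback_smul_dWedge, h1, h2, h3, ← wedgeV_apply, ← wedgeV_apply,
      wedgeV_coeffB_div, smul_smul]
    congr 1
    field_simp

theorem isVanGeemenSartiInvolution_translate : S.IsVanGeemenSartiInvolution S.translate where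
  orderTwo := S.addOrderOf_T BaseField
  translation := S.isTranslation_translate
  nikulin := S.isNikulinInvolution_translate

/-! ## The fibrewise two-isogeny -/

/-- `S'` is the quotient of `S` by translation by `T`, with coordinates rescaled by `m`. -/
structure TwoIsogenous (S S' : TwoTorsionK3) (m : ℂ) : Prop where
  m_ne_zero : m ≠ 0
  A_eq : C (m ^ 2) * S'.A = -2 * S.A
  B_eq : C (m ^ 4) * S'.B = S.A ^ 2 - 4 * S.B

namespace TwoIsogenous

variable {S} {S' : TwoTorsionK3} {m : ℂ}

/-- The scaling factor `m` in a field over `ℂ(v)`. -/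
def scale (m : ℂ) (L : Type) [Field L] [Algebra BaseField L] : L :=
  algebraMap BaseField L (algebraMap ℂ[X] BaseField (C m))

/-- The same identities are used over two fields: over the function field they give the comorphism
through the generic point, over `GeomField` the homomorphism on geometric points. -/
theorem data (h : TwoIsogenous S S' m) (L : Type) [Field L] [Algebra BaseField L] :
    TwoIsogenyData (S.genericFibre.baseChange L) (S'.genericFibre.baseChange L) (scale m L) where
  left := S.isTwoTorsionModel_baseChange L
  right := S'.isTwoTorsionModel_baseChange L
  two_ne_zero := by
    have : CharZero L := charZero_of_injective_algebraMap (algebraMap BaseField L).injective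
    exact two_ne_zero
  m_ne_zero := by simpa [scale] using h.m_ne_zero
  a₄_ne_zero := S.coeffB_ne_zero L
  a₂_eq := by
    have := congrArg (fun p => algebraMap BaseField L (algebraMap ℂ[X] BaseField p)) h.A_eq
    simp only [map_mul, map_pow, map_neg, map_ofNat] at this
    exact this
  a₄_eq := by
    have := congrArg (fun p => algebraMap BaseField L (algebraMap ℂ[X] BaseField p)) h.B_eq
    simp only [map_mul, map_pow, map_ofNat, map_sub] at this
    exact this

theorem scale_ne_zero (h : TwoIsogenous S S' m) (L : Type) [Field L] [Algebra BaseField L] :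
    scale m L ≠ 0 := (h.data L).m_ne_zero

/-- The `x`-coordinate of the image of the generic point. -/
theorem scale_sq_mul (h : TwoIsogenous S S' m) :
    S.y ^ 2 / (scale m S.FunctionField ^ 2 * S.x ^ 2) =
      (S.x + S.coeffA S.FunctionField + S.coeffB S.FunctionField / S.x) /
        scale m S.FunctionField ^ 2 := by
  have := S.x_ne_zero
  have := h.scale_ne_zero S.FunctionField
  rw [S.y_sq]
  field_simp

/-- If X were algebraic over ℂ(v), so would be u = x + B / x, and x, as a root of Z² - u Z + B,
would be algebraic too. -/
theorem transcendental (h : TwoIsogenous S S' m) :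
    Transcendental BaseField (S.y ^ 2 / (scale m S.FunctionField ^ 2 * S.x ^ 2)) := by
  intro ha
  have hx := S.x_ne_zero
  have hm := h.scale_ne_zero S.FunctionField
  rw [h.scale_sq_mul] at ha
  have hu : IsAlgebraic BaseField (S.x + S.coeffB S.FunctionField / S.x) := by
    have h1 := (ha.mul ((isAlgebraic_algebraMap (R := BaseField) (A := S.FunctionField)
      (algebraMap ℂ[X] BaseField (C m))).pow 2)).sub
      (isAlgebraic_algebraMap (R := BaseField) (A := S.FunctionField)
      (algebraMap ℂ[X] BaseField S.A))
    have e : S.x + S.coeffB S.FunctionField / S.x =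
        (S.x + S.coeffA S.FunctionField + S.coeffB S.FunctionField / S.x) /
          scale m S.FunctionField ^ 2 * scale m S.FunctionField ^ 2 -
          S.coeffA S.FunctionField := by
      field_simp
      ring
    rw [e]
    exact h1
  let u : algebraicClosure BaseField S.FunctionField := ⟨_, mem_algebraicClosure_iff.2 hu⟩
  refine S.transcendental_x (IsAlgebraic.restrictScalars BaseField
    (S := algebraicClosure BaseField S.FunctionField)
    ⟨X ^ 2 - C u * X + C (algebraMap BaseField _ (algebraMap ℂ[X] BaseField S.B)), ?_, ?_⟩)
  · exact Monic.ne_zero (by monicity!)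
  · simp only [map_add, map_sub, map_mul, map_pow, aeval_X, aeval_C,
      ← IsScalarTower.algebraMap_apply]
    change S.x ^ 2 - (S.x + S.coeffB S.FunctionField / S.x) * S.x + S.coeffB S.FunctionField = 0
    field_simp
    ring

/-- The comorphism of the two-isogeny. -/
def comorphism (h : TwoIsogenous S S' m) : S'.FunctionField →ₐ[BaseField] S.FunctionField :=
  S'.liftHom ((h.data S.FunctionField).equation S.x_ne_zero S.equation_genericPoint)
    h.transcendental

theorem comorphism_x (h : TwoIsogenous S S' m) :
    h.comorphism S'.x = S.y ^ 2 / (scale m S.FunctionField ^ 2 * S.x ^ 2) :=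
  S'.liftHom_x _ _

theorem comorphism_y (h : TwoIsogenous S S' m) : h.comorphism S'.y =
    S.y * (S.x ^ 2 - S.coeffB S.FunctionField) / (scale m S.FunctionField ^ 3 * S.x ^ 2) :=
  S'.liftHom_y _ _

theorem agreesOnPoints (h : TwoIsogenous S S' m) (L : Type) [Field L] [Algebra BaseField L] :
    AgreesOnPoints S S' L h.comorphism (h.data L).toAddMonoidHom := by
  intro a b hab r s d hd hr hs
  have hx := S.x_ne_zero
  have hm := h.scale_ne_zero S.FunctionField
  have hmL := h.scale_ne_zero L
  -- A denominator vanishing at the generic point would vanish at (a, b).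
  have hd0 : value d S.x S.y ≠ 0 := by
    intro h0
    refine hd ((S.value_eq_of_value_genericPoint_eq hab.1 (r' := 0) ?_).trans ?_)
    · rw [h0]
      exact (map_zero (valueHom S.x S.y)).symm
    · exact map_zero (valueHom a b)
  rw [comorphism_x, h.scale_sq_mul, ratio_eq] at hr
  rw [comorphism_y, ratio_eq] at hs
  -- Relations at the generic point, cleared of denominators, specialize to (a, b). For X the form
  -- (x² + A x + B) / (m² x) is used instead of y² / (m² x²): at a = 0 the specialized relation
  -- reads B d = 0, which rules out the point T, while the other form would only give 0 = 0.
  have er := S.value_eq_of_value_genericPoint_eq hab.1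
    (r := C (C (algebraMap ℂ[X] BaseField (C m))) ^ 2 * C X * r)
    (r' := (C X ^ 2 + C (C (algebraMap ℂ[X] BaseField S.A)) * C X +
      C (C (algebraMap ℂ[X] BaseField S.B))) * d) (by
      simp only [← valueHom_apply, map_mul, map_add, map_pow, valueHom_C_C, valueHom_C_X]
      change scale m S.FunctionField ^ 2 * S.x * value r S.x S.y =
        (S.x ^ 2 + S.coeffA S.FunctionField * S.x + S.coeffB S.FunctionField) * value d S.x S.y
      field_simp at hr
      linear_combination -hr)
  have es := S.value_eq_of_value_genericPoint_eq hab.1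
    (r := C (C (algebraMap ℂ[X] BaseField (C m))) ^ 3 * C X ^ 2 * s)
    (r' := Y * (C X ^ 2 - C (C (algebraMap ℂ[X] BaseField S.B))) * d) (by
      simp only [← valueHom_apply, map_mul, map_sub, map_pow, valueHom_C_C, valueHom_C_X,
        valueHom_Y]
      change scale m S.FunctionField ^ 3 * S.x ^ 2 * value s S.x S.y =
        S.y * (S.x ^ 2 - S.coeffB S.FunctionField) * value d S.x S.y
      field_simp at hs
      linear_combination -hs)
  simp only [← valueHom_apply, map_mul, map_add, map_sub, map_pow, valueHom_C_C, valueHom_C_X,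
    valueHom_Y] at er es
  simp only [valueHom_apply] at er es
  change scale m L ^ 2 * a * value r a b = (a ^ 2 + S.coeffA L * a + S.coeffB L) * value d a b at er
  change scale m L ^ 3 * a ^ 2 * value s a b = b * (a ^ 2 - S.coeffB L) * value d a b at es
  have ha : a ≠ 0 := by
    rintro rfl
    have : S.coeffB L * value d 0 b = 0 := by linear_combination -er
    exact mul_ne_zero (S.coeffB_ne_zero L) hd this
  have hb := S.equation_iff.1 hab.1
  have e1 : value r a b / value d a b = b ^ 2 / (scale m L ^ 2 * a ^ 2) := by
    rw [hb]
    field_simp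
    linear_combination er
  have e2 : value s a b / value d a b = b * (a ^ 2 - S.coeffB L) / (scale m L ^ 3 * a ^ 2) := by
    field_simp
    linear_combination es
  have hf := (h.data L).toFun_some hab ha
  rw [e1, e2]
  exact ⟨_, hf⟩

/-- The two-isogeny with kernel generated by `T`. -/
def isogeny (h : TwoIsogenous S S' m) : Isogeny S S' :=
  ⟨(h.comorphism, (h.data GeomField).toAddMonoidHom), h.agreesOnPoints GeomField⟩

theorem isTwoIsogeny (h : TwoIsogenous S S' m) : h.isogeny.IsTwoIsogeny := by
  have hk : h.isogeny.onPoints.ker = AddSubgroup.zmultiples (S.T GeomField) := by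
    ext P
    rw [AddMonoidHom.mem_ker]
    refine ((h.data GeomField).toFun_eq_zero_iff (T := S.T GeomField) rfl P).trans ⟨?_, ?_⟩
    · rintro (rfl | rfl)
      · exact zero_mem _
      · exact AddSubgroup.mem_zmultiples _
    · rintro ⟨n, rfl⟩
      rcases Int.even_or_odd' n with ⟨k, rfl | rfl⟩
      · left
        change (2 * k) • S.T GeomField = 0
        rw [mul_comm, mul_smul, ofNat_zsmul, S.two_nsmul_T, smul_zero]
      · right
        change (2 * k + 1) • S.T GeomField = S.T GeomField
        rw [add_smul, mul_comm, mul_smul, ofNat_zsmul, S.two_nsmul_T, smul_zero, zero_add,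
          one_smul]
  refine ⟨?_, hk⟩
  rw [hk, Nat.card_zmultiples, S.addOrderOf_T]

theorem areDual {m' : ℂ} (h : TwoIsogenous S S' m) (h' : TwoIsogenous S' S m') (hm : m * m' = 2) :
    h.isogeny.AreDual h'.isogeny := by
  have e : scale m GeomField * scale m' GeomField = 2 := by
    have := congrArg (fun p => algebraMap BaseField GeomField (algebraMap ℂ[X] BaseField (C p))) hm
    simp only [map_mul, map_ofNat] at this
    exact this
  exact ⟨fun P => (h.data GeomField).toFun_toFun (h'.data GeomField) e P,
    fun P => (h'.data GeomField).toFun_toFun (h.data GeomField) (by rw [mul_comm, e]) P⟩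

/-- Translation negates w = y / x, and w² = m² X. Over the image field w generates everything: X
gives x + B / x, the quotient m³ Y / w is x - B / x, their sum gives x, and y = w x. So
`mem_of_fixed` identifies the fixed field. -/
theorem isQuotientBy (h : TwoIsogenous S S' m) : h.isogeny.IsQuotientBy S.translate := by
  have hx := S.x_ne_zero
  have hy := S.y_ne_zero
  have hB := S.coeffB_ne_zero S.FunctionField
  have hm := h.scale_ne_zero S.FunctionField
  have h2 := (h.data S.FunctionField).two_ne_zero
  have hfix : ∀ f, S.translateHom (h.comorphism f) = h.comorphism f := by
    have : S.translateHom.comp h.comorphism = h.comorphism := by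
      have hms : S.translateHom (scale m S.FunctionField) = scale m S.FunctionField :=
        S.translateHom.commutes _
      apply S'.algHom_ext
      · rw [AlgHom.comp_apply, comorphism_x]
        simp only [map_div₀, map_mul, map_pow, hms, translateHom_x, translateHom_y]
        field_simp
      · rw [AlgHom.comp_apply, comorphism_y]
        simp only [map_div₀, map_mul, map_pow, map_sub, hms, translateHom_x, translateHom_y,
          translateHom_coeffB]
        field_simp
        ring
    exact fun f => DFunLike.congr_fun this f
  intro f
  constructor
  · rintro ⟨g, rfl⟩
    exact hfix g
  · intro hf
    have hmem : ∀ g, h.comorphism g ∈ h.comorphism.toRingHom.fieldRange := fun g => ⟨g, rfl⟩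
    have hconst : ∀ c, algebraMap BaseField S.FunctionField c ∈
        h.comorphism.toRingHom.fieldRange := fun c => ⟨_, h.comorphism.commutes c⟩
    have := mem_of_fixed h2 h.comorphism.toRingHom.fieldRange (w := S.y / S.x)
      (div_ne_zero hy hx) ?_ ?_ (S.translateHom : S.FunctionField →+* S.FunctionField) ?_ ?_ hf
    · exact this
    · have e : (S.y / S.x) ^ 2 = scale m S.FunctionField ^ 2 * h.comorphism S'.x := by
        rw [comorphism_x]
        field_simp
      rw [e]
      exact mul_mem (pow_mem (hconst _) 2) (hmem _)
    · intro M hM hw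
      have hu : S.x + S.coeffB S.FunctionField / S.x ∈ M := by
        have e : S.x + S.coeffB S.FunctionField / S.x =
            scale m S.FunctionField ^ 2 * h.comorphism S'.x - S.coeffA S.FunctionField := by
          rw [comorphism_x, h.scale_sq_mul]
          field_simp
          ring
        rw [e]
        exact M.sub_mem (M.mul_mem (M.pow_mem (hM (hconst _)) 2) (hM (hmem _))) (hM (hconst _))
      have hu' : S.x - S.coeffB S.FunctionField / S.x ∈ M := by
        have e : S.x - S.coeffB S.FunctionField / S.x =
            scale m S.FunctionField ^ 3 * h.comorphism S'.y / (S.y / S.x) := by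
          rw [comorphism_y]
          field_simp
        rw [e]
        exact M.div_mem (M.mul_mem (M.pow_mem (hM (hconst _)) 3) (hM (hmem _))) hw
      have hxM : S.x ∈ M := by
        have e : S.x = ((S.x + S.coeffB S.FunctionField / S.x) +
            (S.x - S.coeffB S.FunctionField / S.x)) / 2 := by
          field_simp
          ring
        rw [e]
        exact M.div_mem (M.add_mem hu hu') (ofNat_mem M 2)
      refine S.mem_of_x_mem_of_y_mem M (fun c => hM (hconst c)) hxM ?_
      rw [← div_mul_cancel₀ S.y hx]
      exact M.mul_mem hw hxM
    · rintro _ ⟨g, rfl⟩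
      exact hfix g
    · change S.translateHom (S.y / S.x) = _
      rw [map_div₀, translateHom_x, translateHom_y]
      field_simp

/-- Modulo dv, dX = (1 - B / x²) / m² dx, while 1 / Y = m³ x² / (y (x² - B)); the product is m dx /
y. The constant c allows for the normalization of the form. -/
theorem pullback_twoForm (h : TwoIsogenous S S' m) (c : ℂ) :
    pullback h.isogeny.rationalMap (algebraMap ℂ S'.FunctionField c • S'.twoForm) =
      algebraMap ℂ S.FunctionField (c * m) • S.twoForm := by
  have hx := S.x_ne_zero
  have hy := S.y_ne_zero
  have hm := h.scale_ne_zero S.FunctionField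
  have hy' : h.comorphism S'.y ≠ 0 := by simpa using S'.y_ne_zero
  have hxB : S.x ^ 2 - S.coeffB S.FunctionField ≠ 0 := by
    intro h0
    rw [comorphism_y, h0] at hy'
    simp at hy'
  have e1 : h.isogeny.rationalMap S'.v = S.v := h.comorphism.commutes _
  have e2 : h.isogeny.rationalMap S'.x = _ := h.comorphism_x
  have e3 : h.isogeny.rationalMap S'.y = _ := h.comorphism_y
  have hms : S.wedgeV (scale m S.FunctionField ^ 2) = 0 := by
    rw [scale, ← map_pow, wedgeV_algebraMap]
  have e4 : S.wedgeV ((S.x + S.coeffA S.FunctionField + S.coeffB S.FunctionField / S.x) /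
        scale m S.FunctionField ^ 2) = ((1 - S.coeffB S.FunctionField / S.x ^ 2) /
          scale m S.FunctionField ^ 2) • S.wedgeV S.x := by
    rw [Derivation.leibniz_div, hms, map_add, map_add, wedgeV_coeffB_div, coeffA,
      wedgeV_algebraMap]
    match_scalars
    field_simp
    ring
  have e5 : algebraMap ℂ S.FunctionField (c * m) =
      algebraMap ℂ S.FunctionField c * scale m S.FunctionField := by
    rw [map_mul]
    rfl
  rw [twoForm, smul_smul, pullback_smul_dWedge, map_mul, map_inv₀, e1, e2, e3, h.scale_sq_mul,
    ← wedgeV_apply, e4, AlgHom.commutes, twoForm, smul_smul, smul_smul, ← wedgeV_apply, e5]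
  congr 1
  field_simp

end TwoIsogenous

end TwoTorsionK3

end KummerSandwich

end

noncomputable section

namespace KummerSandwich

open Polynomial
open scoped Polynomial.Bivariate Classical

/-! ## Transcendence -/

/-- The elements of a field that are algebraic over a domain. -/
def algebraicSubfield (R K : Type) [CommRing R] [IsDomain R] [Field K] [Algebra R K] :
    Subfield K where
  carrier := {a | IsAlgebraic R a}
  mul_mem' := IsAlgebraic.mul
  one_mem' := isAlgebraic_one
  add_mem' := IsAlgebraic.add
  zero_mem' := isAlgebraic_zero
  neg_mem' := IsAlgebraic.neg
  inv_mem' _ := IsAlgebraic.inv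

section

variable {K : Type} [Field K] [Algebra ℂ K]

/-- Transcendence in succession amounts to algebraic independence of the pair, a condition on the
set {i, j} and hence symmetric; this is the source of the exchange property. -/
theorem transcendental_and_iff (a : Fin 2 → K) {i j : Fin 2} (hij : i ≠ j) :
    (Transcendental (Algebra.adjoin ℂ {a j}) (a i) ∧ Transcendental ℂ (a j)) ↔
      AlgebraicIndepOn ℂ a {i, j} := by
  rw [AlgebraicIndepOn.insert_iff (by simpa using hij), Set.image_singleton,
    ← algebraicIndependent_singleton_iff (x := fun k : ({j} : Set (Fin 2)) => a k) ⟨j, rfl⟩]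
  exact and_comm

/-- The exchange property for algebraically independent elements. -/
theorem transcendental_swap {a b : K} (ha : Transcendental ℂ a)
    (hb : Transcendental (Algebra.adjoin ℂ {a}) b) :
    Transcendental ℂ b ∧ Transcendental (Algebra.adjoin ℂ {b}) a := by
  have h := (transcendental_and_iff ![a, b] (i := 1) (j := 0) (by decide)).1 ⟨hb, ha⟩
  rw [Set.pair_comm] at h
  exact ((transcendental_and_iff ![a, b] (i := 0) (j := 1) (by decide)).2 h).symm

theorem algebraMap_mem_algebraicSubfield_adjoin (s : Set K) (c : ℂ) :
    algebraMap ℂ K c ∈ algebraicSubfield (Algebra.adjoin ℂ s) K :=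
  isAlgebraic_algebraMap (algebraMap ℂ (Algebra.adjoin ℂ s) c)

theorem mem_algebraicSubfield_adjoin (a : K) :
    a ∈ algebraicSubfield (Algebra.adjoin ℂ {a}) K :=
  isAlgebraic_algebraMap (⟨a, Algebra.self_mem_adjoin_singleton ℂ a⟩ : Algebra.adjoin ℂ {a})

theorem ne_algebraMap_of_transcendental {a : K} (ha : Transcendental ℂ a) (c : ℂ) :
    a ≠ algebraMap ℂ K c := by
  rintro rfl
  exact ha (isAlgebraic_algebraMap c)

/-- The homomorphism from the function field of an elliptic surface given by the values of
`v`, `x` and `y`. -/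
theorem TwoTorsionK3.exists_algHom (S : TwoTorsionK3) {v x y : K} (hv : Transcendental ℂ v)
    (hx : Transcendental (Algebra.adjoin ℂ {v}) x)
    (h : y ^ 2 = x ^ 3 + aeval v S.A * x ^ 2 + aeval v S.B * x) :
    ∃ ψ : S.FunctionField →ₐ[ℂ] K, ψ S.v = v ∧ ψ S.x = x ∧ ψ S.y = y := by
  have hinj : Function.Injective (aeval v : ℂ[X] →ₐ[ℂ] K) :=
    transcendental_iff_injective.1 hv
  let ι : BaseField →ₐ[ℂ] K := IsFractionRing.liftAlgHom hinj
  have hι : ∀ p : ℂ[X], ι (algebraMap ℂ[X] BaseField p) = aeval v p := fun p =>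
    IsFractionRing.lift_algebraMap hinj p
  -- K becomes an extension of ℂ(v) by sending the base variable to the given v, so that `liftHom`
  -- applies to the point (x, y).
  let : Algebra BaseField K := ι.toRingHom.toAlgebra
  let : Algebra ℂ[X] K := (aeval v : ℂ[X] →ₐ[ℂ] K).toRingHom.toAlgebra
  have : IsScalarTower ℂ[X] BaseField K := IsScalarTower.of_algebraMap_eq fun p => (hι p).symm
  let v' : Algebra.adjoin ℂ {v} := ⟨v, Algebra.self_mem_adjoin_singleton ℂ v⟩
  let : Algebra ℂ[X] (Algebra.adjoin ℂ {v}) :=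
    (aeval v' : ℂ[X] →ₐ[ℂ] Algebra.adjoin ℂ {v}).toRingHom.toAlgebra
  have hv' : ∀ p : ℂ[X], ((aeval v' p : Algebra.adjoin ℂ {v}) : K) = aeval v p := fun p => by
    rw [← Subalgebra.coe_val, ← aeval_algHom_apply]
    rfl
  have : IsScalarTower ℂ[X] (Algebra.adjoin ℂ {v}) K :=
    IsScalarTower.of_algebraMap_eq fun p => (hv' p).symm
  have hx' : Transcendental BaseField x := by
    intro hx'
    -- Algebraicity over ℂ(v) descends to the polynomial ring by clearing denominators, and passes
    -- from there to `Algebra.adjoin ℂ {v}`.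
    rw [← IsFractionRing.isAlgebraic_iff ℂ[X] BaseField K] at hx'
    refine hx (hx'.extendScalars ?_)
    intro p q hpq
    refine hinj ?_
    rw [← hv', ← hv']
    exact congrArg _ hpq
  have heq : (S.genericFibre.baseChange K).Equation x y := by
    rw [S.equation_iff, h, ← hι, ← hι]
    rfl
  let ψ := S.liftHom heq hx'
  refine ⟨⟨ψ.toRingHom, fun c => ?_⟩, ?_, S.liftHom_x heq hx', S.liftHom_y heq hx'⟩
  · have h1 : algebraMap ℂ S.FunctionField c =
        algebraMap BaseField S.FunctionField (algebraMap ℂ BaseField c) :=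
      IsScalarTower.algebraMap_apply ℂ BaseField S.FunctionField c
    rw [h1]
    exact (ψ.commutes _).trans (ι.commutes c)
  · refine (ψ.commutes RatFunc.X).trans ?_
    rw [← RatFunc.algebraMap_X]
    exact (hι X).trans (aeval_X v)

end

/-! ## Coordinates on the Kummer surface -/

/-- A field generated by the generic points of two independent Legendre curves. -/
structure LegendrePair (l₁ l₂ : ModularParameter) (K : Type) [Field K] [Algebra ℂ K] where
  x₁ : K
  y₁ : K
  x₂ : K
  y₂ : K
  equation₁ : y₁ ^ 2 = x₁ * (x₁ - 1) * (x₁ - algebraMap ℂ K l₁)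
  equation₂ : y₂ ^ 2 = x₂ * (x₂ - 1) * (x₂ - algebraMap ℂ K l₂)
  transcendental₁ : Transcendental ℂ x₁
  transcendental₂ : Transcendental (Algebra.adjoin ℂ {x₁}) x₂
  generate : ∀ M : Subfield K, (∀ c : ℂ, algebraMap ℂ K c ∈ M) → x₁ ∈ M → y₁ ∈ M → x₂ ∈ M →
    y₂ ∈ M → ∀ f, f ∈ M

namespace LegendrePair

variable {l₁ l₂ : ModularParameter} {K : Type} [Field K] [Algebra ℂ K] (E : LegendrePair l₁ l₂ K)

/-- The base coordinate of the elliptic fibration, before normalization. -/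
def u : K := ((E.x₂ - 1) * (E.x₁ - 1) * (E.x₁ - algebraMap ℂ K l₁) -
  (algebraMap ℂ K l₂ - 1) * algebraMap ℂ K l₁) / E.x₁

variable (l₁ l₂ K) in
/-- The normalizing factor `(λ₁ - 1) (λ₂ - 1) / 4`. -/
def a : K := (algebraMap ℂ K l₁ - 1) * (algebraMap ℂ K l₂ - 1) / 4

/-- The base coordinate of the elliptic fibration. -/
def v : K := (E.u + (algebraMap ℂ K l₂ - 1) * (1 + algebraMap ℂ K l₁) / 2) / a l₁ l₂ K

/-- The fibre coordinate `x` of the elliptic fibration. -/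
def x : K := 4 * algebraMap ℂ K l₁ * (E.v ^ 2 - 4) * (E.x₂ - algebraMap ℂ K l₂) /
  (E.x₁ * (E.x₂ - 1))

/-- The fibre coordinate `y` of the elliptic fibration. -/
def y : K := 8 * a l₁ l₂ K * algebraMap ℂ K l₁ * (E.v ^ 2 - 4) ^ 2 * (E.y₁ * E.y₂) /
  (E.x₁ * (E.x₁ - 1) * (E.x₁ - algebraMap ℂ K l₁) * (E.x₂ - 1) ^ 2)

variable (K) in
theorem charZero : CharZero K :=
  charZero_of_injective_algebraMap (algebraMap ℂ K).injective

variable (l₁ l₂ K) in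
theorem a_ne_zero : a l₁ l₂ K ≠ 0 := by
  have := charZero K
  have h : algebraMap ℂ K (((l₁ : ℂ) - 1) * (l₂ - 1)) ≠ 0 :=
    (_root_.map_ne_zero _).2 (leading_ne_zero l₁ l₂)
  simp only [map_mul, map_sub, map_one] at h
  exact div_ne_zero h (by norm_num)

theorem l_ne_zero (l : ModularParameter) : algebraMap ℂ K l ≠ 0 := by
  simpa using l.2.1

theorem x₁_ne_zero : E.x₁ ≠ 0 := by
  simpa using ne_algebraMap_of_transcendental E.transcendental₁ 0

theorem x₁_sub_one_ne_zero : E.x₁ - 1 ≠ 0 := by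
  simpa [sub_ne_zero] using ne_algebraMap_of_transcendental E.transcendental₁ 1

theorem x₁_sub_ne_zero : E.x₁ - algebraMap ℂ K l₁ ≠ 0 :=
  sub_ne_zero.2 (ne_algebraMap_of_transcendental E.transcendental₁ l₁)

theorem transcendental_x₂ : Transcendental ℂ E.x₂ :=
  (transcendental_swap E.transcendental₁ E.transcendental₂).1

theorem x₂_sub_one_ne_zero : E.x₂ - 1 ≠ 0 := by
  simpa [sub_ne_zero] using ne_algebraMap_of_transcendental E.transcendental_x₂ 1

theorem y₁_ne_zero : E.y₁ ≠ 0 := by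
  have h := E.equation₁
  intro h0
  rw [h0] at h
  exact mul_ne_zero (mul_ne_zero E.x₁_ne_zero E.x₁_sub_one_ne_zero) E.x₁_sub_ne_zero
    (by rw [← h]; ring)

theorem u_eq : E.u = a l₁ l₂ K * E.v - (algebraMap ℂ K l₂ - 1) * (1 + algebraMap ℂ K l₁) / 2 := by
  have := a_ne_zero l₁ l₂ K
  rw [v]
  field_simp
  ring

theorem u_mul_x₁ : E.u * E.x₁ + (algebraMap ℂ K l₂ - 1) * algebraMap ℂ K l₁ =
    (E.x₂ - 1) * (E.x₁ - 1) * (E.x₁ - algebraMap ℂ K l₁) := by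
  rw [u, div_mul_cancel₀ _ E.x₁_ne_zero]
  ring

theorem a_mem (M : Subfield K) (hc : ∀ c : ℂ, algebraMap ℂ K c ∈ M) : a l₁ l₂ K ∈ M :=
  M.div_mem (M.mul_mem (M.sub_mem (hc _) M.one_mem) (M.sub_mem (hc _) M.one_mem)) (ofNat_mem M 4)

/-- Rationality is expressed by membership in an arbitrary subfield M, here and in the next lemmas
of this kind. With M the elements algebraic over a subring it yields transcendence statements; with
M the image of the function field it yields surjectivity. -/
theorem u_mem (M : Subfield K) (hc : ∀ c : ℂ, algebraMap ℂ K c ∈ M) (hv : E.v ∈ M) : E.u ∈ M := by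
  rw [u_eq]
  exact M.sub_mem (M.mul_mem (a_mem M hc) hv) (M.div_mem (M.mul_mem (M.sub_mem (hc _) M.one_mem)
    (M.add_mem M.one_mem (hc _))) (ofNat_mem M 2))

/-- The definition of u is linear in x₂, so x₂ is rational in u and x₁. -/
theorem x₂_mem (M : Subfield K) (hc : ∀ c : ℂ, algebraMap ℂ K c ∈ M) (hx₁ : E.x₁ ∈ M)
    (hv : E.v ∈ M) : E.x₂ ∈ M := by
  have h1 := E.x₁_sub_one_ne_zero
  have h2 := E.x₁_sub_ne_zero
  have e : E.x₂ = 1 + (E.u * E.x₁ + (algebraMap ℂ K l₂ - 1) * algebraMap ℂ K l₁) /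
      ((E.x₁ - 1) * (E.x₁ - algebraMap ℂ K l₁)) := by
    rw [u_mul_x₁]
    field_simp
    ring
  rw [e]
  exact M.add_mem M.one_mem (M.div_mem (M.add_mem (M.mul_mem (E.u_mem M hc hv) hx₁)
    (M.mul_mem (M.sub_mem (hc _) M.one_mem) (hc _)))
    (M.mul_mem (M.sub_mem hx₁ M.one_mem) (M.sub_mem hx₁ (hc _))))

/-- If v were algebraic over ℂ[x₁], then x₂, being rational in v and x₁, would be as well. -/
theorem transcendental_v_adjoin : Transcendental (Algebra.adjoin ℂ {E.x₁}) E.v := fun h =>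
  E.transcendental₂ (E.x₂_mem (algebraicSubfield (Algebra.adjoin ℂ {E.x₁}) K)
    (algebraMap_mem_algebraicSubfield_adjoin _) (mem_algebraicSubfield_adjoin _) h)

theorem transcendental_v : Transcendental ℂ E.v :=
  (transcendental_swap E.transcendental₁ E.transcendental_v_adjoin).1

theorem v_sq_sub_ne_zero : E.v ^ 2 - 4 ≠ 0 := by
  have h1 := ne_algebraMap_of_transcendental E.transcendental_v 2
  have h2 := ne_algebraMap_of_transcendental E.transcendental_v (-2)
  rw [show E.v ^ 2 - 4 = (E.v - 2) * (E.v + 2) by ring]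
  rw [map_ofNat] at h1
  rw [map_neg, map_ofNat] at h2
  refine mul_ne_zero (sub_ne_zero.2 h1) ?_
  rw [← sub_neg_eq_add]
  exact sub_ne_zero.2 h2

/-- The normalization of v moves the two roots u = -(λ₂ - 1) and u = -(λ₂ - 1) λ₁ to v = 2 and v =
-2. Up to sign the product is the determinant of the Möbius transformation taking x₁ to t. -/
theorem a_sq_mul : a l₁ l₂ K ^ 2 * (E.v ^ 2 - 4) =
    (E.u + (algebraMap ℂ K l₂ - 1)) *
      (E.u + (algebraMap ℂ K l₂ - 1) * algebraMap ℂ K l₁) := by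
  have := charZero K
  rw [u_eq, a]
  field_simp
  ring

/-- The ratio of the two sections, `x` up to normalization. -/
def t : K := (E.x₂ - algebraMap ℂ K l₂) / (E.x₁ * (E.x₂ - 1))

theorem x_eq : E.x = 4 * algebraMap ℂ K l₁ * (E.v ^ 2 - 4) * E.t := by
  rw [x, t, mul_div_assoc]

/-- This shows that the denominator t u + (λ₂ - 1) is nonzero when x₁ is solved for in terms of t
and u. -/
theorem t_mul_u_add : (E.t * E.u + (algebraMap ℂ K l₂ - 1)) *
    ((E.x₂ - 1) * (E.x₁ - 1) * (E.x₁ - algebraMap ℂ K l₁)) = a l₁ l₂ K ^ 2 * (E.v ^ 2 - 4) := by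
  have h0 := E.x₁_ne_zero
  have h1 := E.x₂_sub_one_ne_zero
  rw [a_sq_mul, t, u]
  field_simp
  ring

/-- Substituting x₂ in t leaves a quotient of a quadratic by a linear polynomial in x₁, still to be
divided by x₁. The constant (λ₂ - 1) λ₁ subtracted in u makes the constant term of the quadratic
cancel, so t is Möbius in x₁; this is its inverse. -/
theorem x₁_mul_t_mul_u_add : E.x₁ * (E.t * E.u + (algebraMap ℂ K l₂ - 1)) =
    E.u + (algebraMap ℂ K l₂ - 1) * (1 + algebraMap ℂ K l₁) -
      E.t * ((algebraMap ℂ K l₂ - 1) * algebraMap ℂ K l₁) := by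
  have h0 := E.x₁_ne_zero
  have h1 := E.x₂_sub_one_ne_zero
  rw [t, u]
  field_simp
  ring

theorem x₁_mem (M : Subfield K) (hc : ∀ c : ℂ, algebraMap ℂ K c ∈ M) (hv : E.v ∈ M)
    (hx : E.x ∈ M) : E.x₁ ∈ M := by
  have := charZero K
  have hl := l_ne_zero (K := K) l₁
  have hG := E.v_sq_sub_ne_zero
  have ht : E.t ∈ M := by
    have e : E.t = E.x / (4 * algebraMap ℂ K l₁ * (E.v ^ 2 - 4)) := by
      rw [x_eq]
      field_simp
    rw [e]
    exact M.div_mem hx (M.mul_mem (M.mul_mem (ofNat_mem M 4) (hc _))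
      (M.sub_mem (M.pow_mem hv 2) (ofNat_mem M 4)))
  have hu := E.u_mem M hc hv
  have hd : algebraMap ℂ K l₂ - 1 ∈ M := M.sub_mem (hc _) M.one_mem
  have h0 : E.t * E.u + (algebraMap ℂ K l₂ - 1) ≠ 0 := by
    intro h0
    have h := E.t_mul_u_add
    rw [h0, zero_mul] at h
    exact mul_ne_zero (pow_ne_zero 2 (a_ne_zero l₁ l₂ K)) hG h.symm
  rw [eq_div_of_mul_eq h0 E.x₁_mul_t_mul_u_add]
  exact M.div_mem (M.sub_mem (M.add_mem hu (M.mul_mem hd (M.add_mem M.one_mem (hc _))))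
    (M.mul_mem ht (M.mul_mem hd (hc _)))) (M.add_mem (M.mul_mem ht hu) hd)

/-- If x were algebraic over ℂ[v], so would be x₁, which is rational in v and x; this contradicts
the exchanged form of the independence of x₁ and v. -/
theorem transcendental_x : Transcendental (Algebra.adjoin ℂ {E.v}) E.x := fun h =>
  (transcendental_swap E.transcendental₁ E.transcendental_v_adjoin).2
    (E.x₁_mem (algebraicSubfield (Algebra.adjoin ℂ {E.v}) K)
      (algebraMap_mem_algebraicSubfield_adjoin _) (mem_algebraicSubfield_adjoin _) h)

theorem y₁_mul_y₂_mem (M : Subfield K) (hc : ∀ c : ℂ, algebraMap ℂ K c ∈ M) (hv : E.v ∈ M)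
    (hx : E.x ∈ M) (hy : E.y ∈ M) : E.y₁ * E.y₂ ∈ M := by
  have := charZero K
  have hl := l_ne_zero (K := K) l₁
  have hG := E.v_sq_sub_ne_zero
  have ha := a_ne_zero l₁ l₂ K
  have h0 := E.x₁_ne_zero
  have h1 := E.x₁_sub_one_ne_zero
  have h2 := E.x₁_sub_ne_zero
  have h3 := E.x₂_sub_one_ne_zero
  have hx₁ := E.x₁_mem M hc hv hx
  have hx₂ := E.x₂_mem M hc hx₁ hv
  have e : E.y₁ * E.y₂ = E.y * (E.x₁ * (E.x₁ - 1) * (E.x₁ - algebraMap ℂ K l₁) *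
      (E.x₂ - 1) ^ 2) / (8 * a l₁ l₂ K * algebraMap ℂ K l₁ * (E.v ^ 2 - 4) ^ 2) := by
    rw [y]
    field_simp
  rw [e]
  exact M.div_mem (M.mul_mem hy (M.mul_mem (M.mul_mem (M.mul_mem hx₁ (M.sub_mem hx₁ M.one_mem))
    (M.sub_mem hx₁ (hc _))) (M.pow_mem (M.sub_mem hx₂ M.one_mem) 2)))
    (M.mul_mem (M.mul_mem (M.mul_mem (ofNat_mem M 8) (a_mem M hc)) (hc _))
      (M.pow_mem (M.sub_mem (M.pow_mem hv 2) (ofNat_mem M 4)) 2))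

/-- In terms of u, `linearFactor` becomes 4 (u - (1 + λ₁)). The curve relation is then a cubic in t
with leading coefficient λ₁; the factors 4 λ₁ (v² - 4) in x and 8 a λ₁ (v² - 4)² in y make it monic.
-/
theorem equation : E.y ^ 2 = E.x ^ 3 + aeval E.v (kummerSurface l₁ l₂).A * E.x ^ 2 +
    aeval E.v (kummerSurface l₁ l₂).B * E.x := by
  have := charZero K
  have h0 := E.x₁_ne_zero
  have h1 := E.x₁_sub_one_ne_zero
  have h2 := E.x₁_sub_ne_zero
  have h3 := E.x₂_sub_one_ne_zero
  have hL : aeval E.v (linearFactor l₁ l₂) = 4 * (E.u - (1 + algebraMap ℂ K l₁)) := by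
    rw [u_eq, linearFactor]
    simp only [map_sub, map_mul, map_add, aeval_C, aeval_X, map_one, map_ofNat, a]
    field_simp
    ring
  have hA : aeval E.v (kummerSurface l₁ l₂).A =
      (E.v ^ 2 - 4) * (4 * (E.u - (1 + algebraMap ℂ K l₁))) := by
    change aeval E.v ((X ^ 2 - 4) * linearFactor l₁ l₂) = _
    rw [map_mul, hL]
    simp only [map_sub, map_pow, aeval_X, map_ofNat]
  have hB : aeval E.v (kummerSurface l₁ l₂).B =
      16 * algebraMap ℂ K l₁ * algebraMap ℂ K l₂ * (E.v ^ 2 - 4) ^ 2 := by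
    change aeval E.v (C (16 * (l₁ : ℂ) * l₂) * (X ^ 2 - 4) ^ 2) = _
    simp only [map_sub, map_mul, map_pow, aeval_X, aeval_C, map_ofNat]
  have key : a l₁ l₂ K ^ 2 * (E.v ^ 2 - 4) * (E.y₁ ^ 2 * E.y₂ ^ 2) =
      (E.x₁ * (E.x₁ - 1) * (E.x₁ - algebraMap ℂ K l₁) * (E.x₂ - 1) ^ 2) ^ 2 *
      (E.t * (algebraMap ℂ K l₁ * E.t ^ 2 + (E.u - (1 + algebraMap ℂ K l₁)) * E.t +
        algebraMap ℂ K l₂)) := by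
    rw [a_sq_mul, E.equation₁, E.equation₂, t, u]
    field_simp
    ring
  rw [hA, hB, x_eq, y, div_pow, div_eq_iff (by positivity)]
  linear_combination 64 * algebraMap ℂ K l₁ ^ 2 * (E.v ^ 2 - 4) ^ 3 * key

/-- The function field of the elliptic surface is the field of invariants of the inversion. -/
theorem nonempty_algEquiv (σ : K →ₐ[ℂ] K) (hx₁ : σ E.x₁ = E.x₁) (hx₂ : σ E.x₂ = E.x₂)
    (hy₁ : σ E.y₁ = -E.y₁) (hy₂ : σ E.y₂ = -E.y₂) :
    Nonempty ((kummerSurface l₁ l₂).FunctionField ≃ₐ[ℂ] AlgHom.equalizer σ (AlgHom.id ℂ K)) := by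
  have := charZero K
  obtain ⟨ψ, hψv, hψx, hψy⟩ := (kummerSurface l₁ l₂).exists_algHom E.transcendental_v
    E.transcendental_x E.equation
  have hu : σ E.u = E.u := by
    simp only [u, map_div₀, map_sub, map_mul, map_one, hx₁, hx₂, AlgHom.commutes]
  have ha : σ (a l₁ l₂ K) = a l₁ l₂ K := by
    simp only [a, map_div₀, map_sub, map_mul, map_one, map_ofNat, AlgHom.commutes]
  have hv : σ E.v = E.v := by
    simp only [v, map_div₀, map_sub, map_add, map_mul, map_one, map_ofNat, hu, ha,
      AlgHom.commutes]
  have hx : σ E.x = E.x := by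
    simp only [x, map_div₀, map_sub, map_pow, map_mul, map_one, map_ofNat, hv, hx₁, hx₂,
      AlgHom.commutes]
  have hy : σ E.y = E.y := by
    simp only [y, map_div₀, map_sub, map_pow, map_mul, map_one, map_ofNat, hv, ha, hx₁, hx₂, hy₁,
      hy₂, AlgHom.commutes, neg_mul_neg]
  have hfix : ∀ f, σ (ψ f) = ψ f := fun f =>
    (kummerSurface l₁ l₂).mem_of_v_mem (RingHom.eqLocusField (σ.comp ψ).toRingHom ψ.toRingHom)
      (fun c => by
        change σ (ψ _) = ψ _
        rw [ψ.commutes, σ.commutes])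
      (by
        change σ (ψ _) = ψ _
        rw [hψv, hv])
      (by
        change σ (ψ _) = ψ _
        rw [hψx, hx])
      (by
        change σ (ψ _) = ψ _
        rw [hψy, hy]) f
  let L := ψ.toRingHom.fieldRange
  have hcL : ∀ c : ℂ, algebraMap ℂ K c ∈ L := fun c => ⟨_, ψ.commutes c⟩
  have hvL : E.v ∈ L := ⟨_, hψv⟩
  have hxL : E.x ∈ L := ⟨_, hψx⟩
  have hyL : E.y ∈ L := ⟨_, hψy⟩
  have hx₁L : E.x₁ ∈ L := E.x₁_mem L hcL hvL hxL
  have hx₂L : E.x₂ ∈ L := E.x₂_mem L hcL hx₁L hvL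
  have hzL : E.y₁ * E.y₂ ∈ L := E.y₁_mul_y₂_mem L hcL hvL hxL hyL
  -- The image L contains x₁, x₂ and y₁y₂. Adjoining y₁ gives y₂ = y₁y₂ / y₁, hence all of K;
  -- moreover y₁² lies in L and σ negates y₁.
  have hsurj : ∀ f, σ f = f → f ∈ L := fun f hf =>
    mem_of_fixed two_ne_zero L E.y₁_ne_zero
      (by
        rw [E.equation₁]
        exact L.mul_mem (L.mul_mem hx₁L (L.sub_mem hx₁L L.one_mem)) (L.sub_mem hx₁L (hcL _)))
      (fun M hM hy₁M => E.generate M (fun c => hM (hcL c)) (hM hx₁L) hy₁M (hM hx₂L) (by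
        rw [← mul_div_cancel_left₀ E.y₂ E.y₁_ne_zero]
        exact M.div_mem (hM hzL) hy₁M))
      σ.toRingHom (by rintro _ ⟨g, rfl⟩; exact hfix g) hy₁ hf
  refine ⟨AlgEquiv.ofBijective (ψ.codRestrict _ hfix) ⟨?_, ?_⟩⟩
  · exact fun f g hfg => ψ.toRingHom.injective (congrArg Subtype.val hfg)
  · rintro ⟨f, hf⟩
    obtain ⟨g, hg⟩ := hsurj f hf
    exact ⟨g, Subtype.ext hg⟩

end LegendrePair

end KummerSandwich

end

noncomputable section

namespace KummerSandwich

open Polynomial TensorProduct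
open scoped Polynomial.Bivariate Classical

/-! ## The product of two elliptic curves -/

section

variable (W₁ W₂ : WeierstrassCurve.Affine ℂ)

/-- The second curve over the coordinate ring of the first one. -/
abbrev secondCurve : WeierstrassCurve.Affine W₁.CoordinateRing :=
  WeierstrassCurve.map W₂ (algebraMap ℂ W₁.CoordinateRing)

/-- The tensor product of coordinate rings maps to the coordinate ring of the second curve over the
coordinate ring of the first one. -/
def productHom : W₁.CoordinateRing ⊗[ℂ] W₂.CoordinateRing →ₐ[ℂ]
    (secondCurve W₁ W₂).CoordinateRing :=
  Algebra.TensorProduct.productMap (IsScalarTower.toAlgHom ℂ W₁.CoordinateRing _)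
    { WeierstrassCurve.Affine.CoordinateRing.map W₂ (algebraMap ℂ W₁.CoordinateRing) with
      commutes' := fun c => by
        change WeierstrassCurve.Affine.CoordinateRing.map W₂ (algebraMap ℂ W₁.CoordinateRing)
          (WeierstrassCurve.Affine.CoordinateRing.mk W₂ (C (C c))) = _
        rw [WeierstrassCurve.Affine.CoordinateRing.map_mk, map_C, coe_mapRingHom, map_C]
        rfl }

/-- Evaluation of polynomials over the first coordinate ring at the coordinates of the second
curve. -/
def productEval : (W₁.CoordinateRing)[X][Y] →+* W₁.CoordinateRing ⊗[ℂ] W₂.CoordinateRing :=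
  eval₂RingHom (eval₂RingHom Algebra.TensorProduct.includeLeftRingHom
    (1 ⊗ₜ WeierstrassCurve.Affine.CoordinateRing.mk W₂ (C X)))
    (1 ⊗ₜ WeierstrassCurve.Affine.CoordinateRing.mk W₂ Y)

theorem productEval_map (r : ℂ[X][Y]) :
    productEval W₁ W₂ (r.map (mapRingHom (algebraMap ℂ W₁.CoordinateRing))) =
      1 ⊗ₜ WeierstrassCurve.Affine.CoordinateRing.mk W₂ r := by
  have : (productEval W₁ W₂).comp (mapRingHom (mapRingHom (algebraMap ℂ W₁.CoordinateRing))) =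
      (Algebra.TensorProduct.includeRight : W₂.CoordinateRing →ₐ[ℂ]
        W₁.CoordinateRing ⊗[ℂ] W₂.CoordinateRing).toRingHom.comp
        (WeierstrassCurve.Affine.CoordinateRing.mk W₂) := by
    ext c
    · simp only [productEval, RingHom.comp_apply, coe_mapRingHom, map_C, coe_eval₂RingHom, eval₂_C]
      exact ((Algebra.TensorProduct.includeLeft : W₁.CoordinateRing →ₐ[ℂ]
        W₁.CoordinateRing ⊗[ℂ] W₂.CoordinateRing).commutes c).trans
        ((Algebra.TensorProduct.includeRight : W₂.CoordinateRing →ₐ[ℂ]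
        W₁.CoordinateRing ⊗[ℂ] W₂.CoordinateRing).commutes c).symm
    · simp [productEval]
    · simp [productEval]
  exact RingHom.congr_fun this r

/-- The inverse of `productHom`. -/
def productInv : (secondCurve W₁ W₂).CoordinateRing →+*
    W₁.CoordinateRing ⊗[ℂ] W₂.CoordinateRing :=
  Ideal.Quotient.lift _ (productEval W₁ W₂) (by
    intro p hp
    obtain ⟨q, rfl⟩ := Ideal.mem_span_singleton.1 hp
    rw [map_mul, WeierstrassCurve.Affine.map_polynomial, productEval_map, AdjoinRoot.mk_self,
      TensorProduct.tmul_zero, zero_mul])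

theorem productInv_productHom (f : W₁.CoordinateRing ⊗[ℂ] W₂.CoordinateRing) :
    productInv W₁ W₂ (productHom W₁ W₂ f) = f := by
  induction f using TensorProduct.induction_on with
  | zero => rw [map_zero, map_zero]
  | add f g hf hg => rw [map_add, map_add, hf, hg]
  | tmul f g =>
    obtain ⟨r, rfl⟩ := AdjoinRoot.mk_surjective g
    have h1 : productInv W₁ W₂ (algebraMap W₁.CoordinateRing _ f) = f ⊗ₜ 1 := by
      change productEval W₁ W₂ (C (C f)) = _
      simp [productEval]
    have h2 := productEval_map W₁ W₂ r
    rw [productHom, Algebra.TensorProduct.productMap_apply_tmul, map_mul]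
    refine (congrArg₂ _ h1 ((congrArg _ (WeierstrassCurve.Affine.CoordinateRing.map_mk
      (algebraMap ℂ W₁.CoordinateRing) r)).trans h2)).trans ?_
    rw [Algebra.TensorProduct.tmul_mul_tmul, mul_one, one_mul]

/-- By the left inverse `productInv`, the tensor product embeds in the coordinate ring of a
Weierstrass curve over the domain ℂ[E₁], which is a domain. -/
instance isDomain_tensorProduct : IsDomain (W₁.CoordinateRing ⊗[ℂ] W₂.CoordinateRing) :=
  Function.Injective.isDomain (productHom W₁ W₂).toRingHom
    (Function.LeftInverse.injective (productInv_productHom W₁ W₂))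

theorem transcendental_mk_X (W : WeierstrassCurve.Affine ℂ) :
    Transcendental ℂ (WeierstrassCurve.Affine.CoordinateRing.mk W (C X)) := by
  rintro ⟨p, hp, h⟩
  refine hp ((FaithfulSMul.algebraMap_eq_zero_iff ℂ[X] W.CoordinateRing).1 ?_)
  rw [← h]
  have := aeval_algHom_apply (IsScalarTower.toAlgHom ℂ ℂ[X] W.CoordinateRing) X p
  rw [aeval_X_left_apply] at this
  exact this.symm

/-- Under `productHom` the element becomes the polynomial variable over the first coordinate ring,
and polynomials embed in the coordinate ring of `secondCurve`. -/
theorem transcendental_tmul_mk_X : Transcendental W₁.CoordinateRing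
    (1 ⊗ₜ WeierstrassCurve.Affine.CoordinateRing.mk W₂ (C X) :
      W₁.CoordinateRing ⊗[ℂ] W₂.CoordinateRing) := by
  rintro ⟨p, hp, h⟩
  refine hp ((FaithfulSMul.algebraMap_eq_zero_iff (W₁.CoordinateRing)[X]
    (secondCurve W₁ W₂).CoordinateRing).1 ?_)
  have hx : productHom W₁ W₂ (1 ⊗ₜ WeierstrassCurve.Affine.CoordinateRing.mk W₂ (C X)) =
      algebraMap (W₁.CoordinateRing)[X] (secondCurve W₁ W₂).CoordinateRing X := by
    rw [productHom, Algebra.TensorProduct.productMap_apply_tmul, map_one, one_mul]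
    refine (WeierstrassCurve.Affine.CoordinateRing.map_mk
      (algebraMap ℂ W₁.CoordinateRing) (C X)).trans ?_
    rw [map_C, coe_mapRingHom, map_X]
    rfl
  have h1 := congrArg (productHom W₁ W₂) h
  rw [aeval_def, ← AlgHom.coe_toRingHom, hom_eval₂, map_zero] at h1
  rw [← h1]
  have e : (productHom W₁ W₂).toRingHom.comp (algebraMap W₁.CoordinateRing _) =
      algebraMap W₁.CoordinateRing (secondCurve W₁ W₂).CoordinateRing := by
    refine RingHom.ext fun f => ?_
    change productHom W₁ W₂ (f ⊗ₜ 1) = _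
    rw [productHom, Algebra.TensorProduct.productMap_apply_tmul, map_one, mul_one]
    rfl
  have e2 := aeval_algHom_apply (IsScalarTower.toAlgHom W₁.CoordinateRing (W₁.CoordinateRing)[X]
    (secondCurve W₁ W₂).CoordinateRing) X p
  rw [aeval_X_left_apply, aeval_def] at e2
  refine e2.symm.trans ?_
  exact (congrArg₂ (fun g b => eval₂ g b p) e hx).symm

end

theorem legendre_equation (l : ℂ) :
    WeierstrassCurve.Affine.CoordinateRing.mk (legendre l) Y ^ 2 =
      WeierstrassCurve.Affine.CoordinateRing.mk (legendre l) (C X) *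
      (WeierstrassCurve.Affine.CoordinateRing.mk (legendre l) (C X) - 1) *
      (WeierstrassCurve.Affine.CoordinateRing.mk (legendre l) (C X) -
        algebraMap ℂ (legendre l).CoordinateRing l) := by
  have h : WeierstrassCurve.Affine.CoordinateRing.mk (legendre l) (legendre l).polynomial = 0 :=
    AdjoinRoot.mk_self
  have hc : algebraMap ℂ (legendre l).CoordinateRing l =
    WeierstrassCurve.Affine.CoordinateRing.mk (legendre l) (C (C l)) := rfl
  have e : (legendre l).polynomial = Y ^ 2 - (C X ^ 3 - (1 + C (C l)) * C X ^ 2 + C (C l) * C X) := by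
    simp only [WeierstrassCurve.Affine.polynomial, legendre, map_add, map_mul, map_pow,
      map_neg, map_zero, map_one]
    ring
  replace h := (congrArg (WeierstrassCurve.Affine.CoordinateRing.mk (legendre l)) e).symm.trans h
  simp only [map_add, map_sub, map_mul, map_pow, map_one] at h
  rw [hc]
  linear_combination h

/-- A subfield containing the coordinates contains the coordinate ring. -/
theorem coordinateRing_mem {W : WeierstrassCurve.Affine ℂ} {K : Type} [Field K]
    (φ : W.CoordinateRing →+* K) (M : Subfield K)
    (hc : ∀ c : ℂ, φ (algebraMap ℂ W.CoordinateRing c) ∈ M)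
    (hx : φ (WeierstrassCurve.Affine.CoordinateRing.mk W (C X)) ∈ M)
    (hy : φ (WeierstrassCurve.Affine.CoordinateRing.mk W Y) ∈ M) (f : W.CoordinateRing) :
    φ f ∈ M := by
  obtain ⟨r, rfl⟩ := AdjoinRoot.mk_surjective f
  induction r using Polynomial.induction_on' with
  | add p q hp hq =>
    rw [map_add, map_add]
    exact M.add_mem hp hq
  | monomial n p =>
    rw [← C_mul_X_pow_eq_monomial, map_mul, map_pow, map_mul, map_pow]
    refine M.mul_mem ?_ (M.pow_mem hy n)
    induction p using Polynomial.induction_on' with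
    | add p q hp hq =>
      rw [map_add, map_add, map_add]
      exact M.add_mem hp hq
    | monomial k c =>
      rw [← C_mul_X_pow_eq_monomial, map_mul, map_pow, map_mul, map_pow, map_mul, map_pow]
      exact M.mul_mem (hc c) (M.pow_mem hx k)

/-! ### The function field of the product and its inversion -/

section

variable (l₁ l₂ : ModularParameter)

/-- The inclusion of the first coordinate ring. -/
def inclLeft (W₁ W₂ : WeierstrassCurve.Affine ℂ) : W₁.CoordinateRing →ₐ[ℂ] ProductField W₁ W₂ :=
  (IsScalarTower.toAlgHom ℂ (W₁.CoordinateRing ⊗[ℂ] W₂.CoordinateRing) _).comp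
    Algebra.TensorProduct.includeLeft

/-- The inclusion of the second coordinate ring. -/
def inclRight (W₁ W₂ : WeierstrassCurve.Affine ℂ) : W₂.CoordinateRing →ₐ[ℂ] ProductField W₁ W₂ :=
  (IsScalarTower.toAlgHom ℂ (W₁.CoordinateRing ⊗[ℂ] W₂.CoordinateRing) _).comp
    Algebra.TensorProduct.includeRight

theorem inclLeft_injective (W₁ W₂ : WeierstrassCurve.Affine ℂ) :
    Function.Injective (inclLeft W₁ W₂) :=
  (IsFractionRing.injective (W₁.CoordinateRing ⊗[ℂ] W₂.CoordinateRing)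
    (ProductField W₁ W₂)).comp (Algebra.TensorProduct.includeLeft_injective
      (FaithfulSMul.algebraMap_injective ℂ W₂.CoordinateRing))

/-- Algebraicity over ℂ[x₁] would imply algebraicity over the larger first coordinate ring, and
injectivity of the map to the fraction field would bring the relation back to the tensor product,
against `transcendental_tmul_mk_X`. -/
theorem transcendental_inclRight (W₁ W₂ : WeierstrassCurve.Affine ℂ) : Transcendental
    (Algebra.adjoin ℂ {inclLeft W₁ W₂ (WeierstrassCurve.Affine.CoordinateRing.mk W₁ (C X))})
    (inclRight W₁ W₂ (WeierstrassCurve.Affine.CoordinateRing.mk W₂ (C X))) := by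
  intro h
  have hle : Algebra.adjoin ℂ {inclLeft W₁ W₂ (WeierstrassCurve.Affine.CoordinateRing.mk W₁ (C X))} ≤
      (inclLeft W₁ W₂).range := Algebra.adjoin_le (by rintro _ rfl; exact ⟨_, rfl⟩)
  have h2 : IsAlgebraic (inclLeft W₁ W₂).range
      (inclRight W₁ W₂ (WeierstrassCurve.Affine.CoordinateRing.mk W₂ (C X))) := by
    let := (Subalgebra.inclusion hle).toRingHom.toAlgebra
    have : IsScalarTower
        (Algebra.adjoin ℂ {inclLeft W₁ W₂ (WeierstrassCurve.Affine.CoordinateRing.mk W₁ (C X))})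
        (inclLeft W₁ W₂).range (ProductField W₁ W₂) := IsScalarTower.of_algebraMap_eq fun _ => rfl
    exact h.extendScalars (Subalgebra.inclusion_injective hle)
  have h3 : IsAlgebraic W₁.CoordinateRing
      (inclRight W₁ W₂ (WeierstrassCurve.Affine.CoordinateRing.mk W₂ (C X))) := by
    -- The coefficients of the relation are lifted from the image of the first coordinate ring to
    -- the ring itself.
    obtain ⟨p, hp, hp0⟩ := h2
    obtain ⟨q, rfl⟩ := Polynomial.map_surjective (inclLeft W₁ W₂).rangeRestrict.toRingHom
      (AlgHom.rangeRestrict_surjective _) p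
    refine ⟨q, ?_, ?_⟩
    · rintro rfl
      simp at hp
    · have e : algebraMap W₁.CoordinateRing (ProductField W₁ W₂) = (inclLeft W₁ W₂).toRingHom :=
        RingHom.ext fun f => IsScalarTower.algebraMap_apply W₁.CoordinateRing
          (W₁.CoordinateRing ⊗[ℂ] W₂.CoordinateRing) (ProductField W₁ W₂) f
      rw [aeval_def, eval₂_map] at hp0
      rw [aeval_def, e]
      exact hp0
  refine transcendental_tmul_mk_X W₁ W₂ ((isAlgebraic_algebraMap_iff
    (IsFractionRing.injective (W₁.CoordinateRing ⊗[ℂ] W₂.CoordinateRing)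
    (ProductField W₁ W₂))).1 h3)

/-- The generic points of the two Legendre curves. -/
def legendrePair : LegendrePair l₁ l₂ (ProductField (legendre l₁) (legendre l₂)) where
  x₁ := inclLeft _ _ (WeierstrassCurve.Affine.CoordinateRing.mk _ (C X))
  y₁ := inclLeft _ _ (WeierstrassCurve.Affine.CoordinateRing.mk _ Y)
  x₂ := inclRight _ _ (WeierstrassCurve.Affine.CoordinateRing.mk _ (C X))
  y₂ := inclRight _ _ (WeierstrassCurve.Affine.CoordinateRing.mk _ Y)
  equation₁ := by
    have h := congrArg (inclLeft (legendre l₁) (legendre l₂)) (legendre_equation l₁)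
    simpa only [map_mul, map_sub, map_pow, map_one, AlgHom.commutes] using h
  equation₂ := by
    have h := congrArg (inclRight (legendre l₁) (legendre l₂)) (legendre_equation l₂)
    simpa only [map_mul, map_sub, map_pow, map_one, AlgHom.commutes] using h
  transcendental₁ := fun h => transcendental_mk_X _
    ((isAlgebraic_algHom_iff _ (inclLeft_injective _ _)).1 h)
  transcendental₂ := transcendental_inclRight _ _
  generate := by
    intro M hc hx₁ hy₁ hx₂ hy₂ f
    have h1 := coordinateRing_mem (inclLeft (legendre l₁) (legendre l₂)).toRingHom M
      (fun c => by
        have := hc c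
        rwa [← (inclLeft (legendre l₁) (legendre l₂)).commutes] at this) hx₁ hy₁
    have h2 := coordinateRing_mem (inclRight (legendre l₁) (legendre l₂)).toRingHom M
      (fun c => by
        have := hc c
        rwa [← (inclRight (legendre l₁) (legendre l₂)).commutes] at this) hx₂ hy₂
    have key : ∀ g, algebraMap ((legendre l₁).CoordinateRing ⊗[ℂ] (legendre l₂).CoordinateRing)
        (ProductField (legendre l₁) (legendre l₂)) g ∈ M := by
      intro g
      induction g using TensorProduct.induction_on with
      | zero =>
        rw [map_zero]
        exact M.zero_mem
      | add f g hf hg =>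
        rw [map_add]
        exact M.add_mem hf hg
      | tmul f g =>
        have e : f ⊗ₜ[ℂ] g = (f ⊗ₜ 1) * (1 ⊗ₜ g) := by
          rw [Algebra.TensorProduct.tmul_mul_tmul, mul_one, one_mul]
        rw [e, map_mul]
        exact M.mul_mem (h1 f) (h2 g)
    obtain ⟨g, d, -, rfl⟩ := IsFractionRing.div_surjective
      (A := (legendre l₁).CoordinateRing ⊗[ℂ] (legendre l₂).CoordinateRing) f
    exact M.div_mem (key g) (key d)

theorem productInversion_inclLeft (W₁ W₂ : WeierstrassCurve.Affine ℂ) (f : W₁.CoordinateRing) :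
    productInversion W₁ W₂ (inclLeft W₁ W₂ f) = inclLeft W₁ W₂ (inversionHom W₁ f) := by
  have h := IsFractionRing.algEquivOfAlgEquiv_algebraMap
    (K := ProductField W₁ W₂) (L := ProductField W₁ W₂)
    (Algebra.TensorProduct.congr (inversion W₁) (inversion W₂)) (f ⊗ₜ 1)
  refine h.trans ?_
  rw [Algebra.TensorProduct.congr_apply, Algebra.TensorProduct.map_tmul, map_one]
  rfl

theorem productInversion_inclRight (W₁ W₂ : WeierstrassCurve.Affine ℂ) (f : W₂.CoordinateRing) :
    productInversion W₁ W₂ (inclRight W₁ W₂ f) = inclRight W₁ W₂ (inversionHom W₂ f) := by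
  have h := IsFractionRing.algEquivOfAlgEquiv_algebraMap
    (K := ProductField W₁ W₂) (L := ProductField W₁ W₂)
    (Algebra.TensorProduct.congr (inversion W₁) (inversion W₂)) (1 ⊗ₜ f)
  refine h.trans ?_
  rw [Algebra.TensorProduct.congr_apply, Algebra.TensorProduct.map_tmul, map_one]
  rfl

theorem inversionHom_X (W : WeierstrassCurve.Affine ℂ) :
    inversionHom W (WeierstrassCurve.Affine.CoordinateRing.mk W (C X)) =
      WeierstrassCurve.Affine.CoordinateRing.mk W (C X) :=
  AdjoinRoot.liftAlgHom_of _ _ _ _ X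

theorem inversionHom_legendre_Y (l : ℂ) :
    inversionHom (legendre l) (WeierstrassCurve.Affine.CoordinateRing.mk (legendre l) Y) =
      -WeierstrassCurve.Affine.CoordinateRing.mk (legendre l) Y := by
  refine (AdjoinRoot.liftAlgHom_root _ _ _ _).trans ?_
  rw [← map_neg]
  congr 1
  simp [WeierstrassCurve.Affine.negPolynomial, legendre]

theorem nonempty_kummerField_algEquiv : Nonempty ((kummerSurface l₁ l₂).FunctionField ≃ₐ[ℂ]
    kummerField (legendre l₁) (legendre l₂)) := by
  refine (legendrePair l₁ l₂).nonempty_algEquiv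
    (productInversion (legendre l₁) (legendre l₂) : _ →ₐ[ℂ] _) ?_ ?_ ?_ ?_
  · refine (productInversion_inclLeft _ _ _).trans (congrArg _ (inversionHom_X _))
  · refine (productInversion_inclRight _ _ _).trans (congrArg _ (inversionHom_X _))
  · refine (productInversion_inclLeft _ _ _).trans ((congrArg _ (inversionHom_legendre_Y _)).trans ?_)
    exact map_neg _ _
  · refine (productInversion_inclRight _ _ _).trans
      ((congrArg _ (inversionHom_legendre_Y _)).trans ?_)
    exact map_neg _ _

end

end KummerSandwich

end

/-! ### The two quotient relations between 𝒮 and 𝒴' -/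

noncomputable section

namespace KummerSandwich

open Polynomial
open scoped Polynomial.Bivariate Classical

/-- The coefficients -1/2 and 1/16 of 𝒴' are the -2 / m² and 1 / m⁴ of the quotient formulas at m =
2. -/
theorem twoIsogenous_kummer_isogenous (l₁ l₂ : ModularParameter) :
    (kummerSurface l₁ l₂).TwoIsogenous (isogenousSurface l₁ l₂) 2 where
  m_ne_zero := two_ne_zero
  A_eq := by
    have e : C ((2 : ℂ) ^ 2) * C (-1 / 2 : ℂ) = -2 := by
      rw [← C_mul, show (2 : ℂ) ^ 2 * (-1 / 2) = -2 by norm_num, map_neg, map_ofNat]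
    change C ((2 : ℂ) ^ 2) * (C (-1 / 2) * (X ^ 2 - 4) * linearFactor l₁ l₂) =
      -2 * ((X ^ 2 - 4) * linearFactor l₁ l₂)
    linear_combination ((X ^ 2 - 4) * linearFactor l₁ l₂) * e
  B_eq := by
    have e : C ((2 : ℂ) ^ 4) * C (1 / 16 : ℂ) = 1 := by
      rw [← C_mul, show (2 : ℂ) ^ 4 * (1 / 16) = 1 by norm_num, map_one]
    have e' : C (64 * (l₁ : ℂ) * l₂) = 4 * C (16 * (l₁ : ℂ) * l₂) := by
      simp only [map_mul, map_ofNat]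
      ring
    change C ((2 : ℂ) ^ 4) * (C (1 / 16) * (X ^ 2 - 4) ^ 2 *
        (linearFactor l₁ l₂ ^ 2 - C (64 * (l₁ : ℂ) * l₂))) =
      ((X ^ 2 - 4) * linearFactor l₁ l₂) ^ 2 - 4 * (C (16 * (l₁ : ℂ) * l₂) * (X ^ 2 - 4) ^ 2)
    rw [e']
    linear_combination ((X ^ 2 - 4) ^ 2 * (linearFactor l₁ l₂ ^ 2 -
      4 * C (16 * (l₁ : ℂ) * l₂))) * e

/-- Taking the quotient twice without scaling replaces A, B by 4A, 16B. The scaling m = 2 in the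
first step already absorbs these factors, so the second needs none. -/
theorem twoIsogenous_isogenous_kummer (l₁ l₂ : ModularParameter) :
    (isogenousSurface l₁ l₂).TwoIsogenous (kummerSurface l₁ l₂) 1 := by
  have h := twoIsogenous_kummer_isogenous l₁ l₂
  have hA := h.A_eq
  have hB := h.B_eq
  simp only [map_pow, map_ofNat] at hA hB
  constructor
  · exact one_ne_zero
  · rw [one_pow, map_one]
    refine mul_left_cancel₀ (two_ne_zero (α := ℂ[X])) ?_
    linear_combination hA
  · rw [one_pow, map_one]
    refine mul_left_cancel₀ (pow_ne_zero 4 (two_ne_zero (α := ℂ[X]))) ?_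
    linear_combination 4 * hB - (4 * (isogenousSurface l₁ l₂).A - 2 * (kummerSurface l₁ l₂).A) * hA

end KummerSandwich

end

theorem mainTheorem6 (l₁ l₂ : KummerSandwich.ModularParameter) :
    Nonempty ((KummerSandwich.kummerSurface l₁ l₂).FunctionField ≃ₐ[ℂ] KummerSandwich.kummerField
      (KummerSandwich.legendre l₁) (KummerSandwich.legendre l₂)) ∧
    ∃ (k' : (KummerSandwich.isogenousSurface l₁ l₂).FunctionField ≃ₐ[KummerSandwich.BaseField]
          (KummerSandwich.isogenousSurface l₁ l₂).FunctionField)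
      (k : (KummerSandwich.kummerSurface l₁ l₂).FunctionField ≃ₐ[KummerSandwich.BaseField]
          (KummerSandwich.kummerSurface l₁ l₂).FunctionField)
      (χ : KummerSandwich.TwoTorsionK3.Isogeny
          (KummerSandwich.kummerSurface l₁ l₂) (KummerSandwich.isogenousSurface l₁ l₂))
      (χ' : KummerSandwich.TwoTorsionK3.Isogeny
          (KummerSandwich.isogenousSurface l₁ l₂) (KummerSandwich.kummerSurface l₁ l₂)),
      (KummerSandwich.isogenousSurface l₁ l₂).IsVanGeemenSartiInvolution k' ∧
      (KummerSandwich.kummerSurface l₁ l₂).IsVanGeemenSartiInvolution k ∧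
      χ.IsTwoIsogeny ∧ χ'.IsTwoIsogeny ∧ χ.AreDual χ' ∧
      χ.IsQuotientBy k ∧ χ'.IsQuotientBy k' ∧
      KummerSandwich.pullback χ.rationalMap (KummerSandwich.isogenousTwoForm l₁ l₂) =
        KummerSandwich.kummerTwoForm l₁ l₂ ∧
      KummerSandwich.pullback χ'.rationalMap (KummerSandwich.kummerTwoForm l₁ l₂) =
        (2 : (KummerSandwich.isogenousSurface l₁ l₂).FunctionField) •
          KummerSandwich.isogenousTwoForm l₁ l₂ := by
  have h := KummerSandwich.twoIsogenous_kummer_isogenous l₁ l₂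
  have h' := KummerSandwich.twoIsogenous_isogenous_kummer l₁ l₂
  refine ⟨KummerSandwich.nonempty_kummerField_algEquiv l₁ l₂, _, _, h.isogeny, h'.isogeny,
    (KummerSandwich.isogenousSurface l₁ l₂).isVanGeemenSartiInvolution_translate,
    (KummerSandwich.kummerSurface l₁ l₂).isVanGeemenSartiInvolution_translate,
    h.isTwoIsogeny, h'.isTwoIsogeny, h.areDual h' (by norm_num), h.isQuotientBy, h'.isQuotientBy,
    ?_, ?_⟩
  -- With c = 1 and m = 2 the factor c m is the 2 in ω_𝒮. In the other direction c = 2 is that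
  -- normalization and m = 1.
  · have e := h.pullback_twoForm 1
    rwa [map_one, one_smul, one_mul, map_ofNat] at e
  · have e := h'.pullback_twoForm 2
    rwa [mul_one, map_ofNat, map_ofNat] at e
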